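/- **Setting.** Let $n\ge 1$, let $y_1,\dots,y_n$ be observations with likelihood $p(y\mid f)$, $f\in\mathbb R$, and let $r=(m,V)$ with $m\in\mathbb R^k$ and $V$ a symmetric $k\times k$ matrix; the parameter space carries the Euclidean norm of the vectorized pair $(m,V)$. For given vectors $a_{i,1},a_{i,2}\in\mathbb R^k$ and scalars $b_{i,1},b_{i,2}$ put $\mu_i(r)=a_{i,1}^\top m+b_{i,1}$, $v_i(r)=a_{i,2}^\top Va_{i,2}+b_{i,2}$ and $q(f_i\mid r)=\mathcal N(\mu_i(r),v_i(r))$. Let $\beta\ge 0$, let $\mathcal N(m_0,K_0)$ be a prior with $K_0$ positive definite, and let $$h(r)=-\frac1n\sum_{i=1}^n\log \mathbb E_{q(f_i\mid r)}[p(y_i\mid f_i)]+\frac{\beta}{n}\,d_{KL}\big(\mathcal N(m,V)\,\|\,\mathcal N(m_0,K_0)\big)$$ be the log-loss DLM objective. Let $\phi_i(r,\epsilon),\phi_i'(r,\epsilon),\phi_i''(r,\epsilon)$ be the value, first and second derivative of $f\mapsto p(y_i\mid f)$ at $f=\sqrt{v_i(r)}\,\epsilon+\mu_i(r)$; expectations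 $\mathbb E$ of these are over $\epsilon\sim\mathcal N(0,1)$. For samples $\epsilon^{(1)},\dots,\epsilon^{(L)}$ the biased Monte Carlo (bMC) direction is $$d=\frac1n\sum_{i=1}^n\left(\frac{\sum_{\ell}\phi_i'(r,\epsilon^{(\ell)})}{\sum_{\ell}\phi_i(r,\epsilon^{(\ell)})}\,a_{i,1},\ \frac{\sum_{\ell}\phi_i''(r,\epsilon^{(\ell)})}{\sum_{\ell}\phi_i(r,\epsilon^{(\ell)})}\,\frac{a_{i,2}a_{i,2}^\top}{2}\right)-\frac{\beta}{n}\nabla_r d_{KL},$$ where the samples may be shared between examples or may depend on $i$. bMC iterates $r_{t+1}=r_t+\gamma_td_t$, where $r_t$ and the sample size $L_t$ depend only on the past, and $d_t$ is the bMC direction at $r_t$ with $L_t$ samples which, for each $i$, are i.i.d. $\mathcal N(0,1)$ and independent of the past. **Assumptions.** For each $i$, $f\mapsto p(y_i\mid f)$ is twice differentiable, with $0\le\phi_i\le B$, $b'\le\phi_i'\le B'$ and $b''\le\phi_i''\le B''$ for finite constants. The step sizes satisfy $\gamma_t>0$, $\sum_t\gamma_t=\infty$, $\sum_t\gamma_t^2<\infty$;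 $\delta_t>0$ and $\sum_t\delta_t=\delta$. There are constants $\zeta,\lambda>0$ such that almost surely all iterates lie in the set $S$ of those $r$ for which, for all $i$, $\mathbb E_{q(f_i\mid r)}[p(y_i\mid f_i)]\ge\zeta$ and $v_i(r)\ge\lambda$, and, in case $\beta>0$, $V\succeq\lambda I$. Almost surely, for all $t$ and $i$, $$L_t>\frac{\log(6n/\delta_t)}{2\gamma_t^2}\,M,\qquad M=\max\left\{\frac{B^2}{|\mathbb E\phi_i(r_t,\epsilon)|^2},\ \frac{(B'-b')^2}{P^2},\ \frac{(B''-b'')^2}{Q^2}\right\},$$ where $P=|\mathbb E\phi_i'(r_t,\epsilon)|$ if this is nonzero and $P=1$ otherwise, and $Q=|\mathbb E\phi_i''(r_t,\epsilon)|$ if this is nonzero and $Q=1$ otherwise. **Conclusion.** There are (non-random) positive constants $c_1,c_2,c_3,c_4$ and a constant $\Lambda$ such that with probability at least $1-\delta$ the bMC iterates satisfy the following conditions for convergence of a gradient method with errors: $h$ is differentiable at every point of $S$ and $\nabla h$ is $\Lambda$-Lipschitz on $S$, which contains all $r_t$; $\sum_t\gamma_t=\infty$ and $\sum_t\gamma_t^2<\infty$;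 and $r_{t+1}=r_t+\gamma_td_t$ with $d_t=s_t+w_t$ such that for all $t$ $$c_1\|\nabla h(r_t)\|^2\le-\nabla h(r_t)^\top s_t,\qquad \|s_t\|\le c_2\|\nabla h(r_t)\|,\qquad \|w_t\|\le\gamma_t\,(c_3+c_4\|\nabla h(r_t)\|);$$ and, on the same event, $h(r_t)$ converges to a finite limit and $\nabla h(r_t)\to0$. -/

import Mathlib

open MeasureTheory ProbabilityTheory Filter Topology
open scoped NNReal ENNReal Matrix Gradient

noncomputable section

namespace DLM

/-- Symmetric `k × k` real matrices, vectorized: a subspace of `ℝ^(k × k)` with the Euclidean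
(Frobenius) inner product. -/
def SymMat (k : ℕ) : Submodule ℝ (EuclideanSpace ℝ (Fin k × Fin k)) where
  carrier := {V | ∀ i j, V (i, j) = V (j, i)}
  add_mem' := by
    intro a b ha hb i j
    simp [ha i j, hb i j]
  zero_mem' := by
    intro i j
    simp
  smul_mem' := by
    intro c a ha i j
    simp [ha i j]

/-- The parameter space of pairs `r = (m, V)`, with the Euclidean norm of the concatenation of `m`
and the vectorization of `V`. -/
abbrev Param (k : ℕ) : Type := WithLp 2 (EuclideanSpace ℝ (Fin k) × SymMat k)

/-- The mean parameter `m` of `r = (m, V)`. -/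
def Param.m {k : ℕ} (r : Param k) : EuclideanSpace ℝ (Fin k) := r.fst

/-- The covariance parameter `V` of `r = (m, V)`, as a matrix. -/
def Param.V {k : ℕ} (r : Param k) : Matrix (Fin k) (Fin k) ℝ :=
  Matrix.of fun i j => (r.snd : EuclideanSpace ℝ (Fin k × Fin k)) (i, j)

/-- The vectorization of the rank one matrix `a aᵀ`. -/
def outer {k : ℕ} (a : EuclideanSpace ℝ (Fin k)) : SymMat k :=
  ⟨WithLp.toLp 2 fun ij => a ij.1 * a ij.2, fun i j => by simp [mul_comm]⟩

/-- The data of the learning problem: `n` observations `y i`, the likelihood `p(y | f)`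
(written `p y f`), the vectors and scalars that determine the marginals
`q(f_i | r) = N(a_{i,1}ᵀ m + b_{i,1}, a_{i,2}ᵀ V a_{i,2} + b_{i,2})`, the Gaussian prior
`N(m₀, K₀)`, and the regularization parameter `β`. -/
structure Model (Y : Type*) (n k : ℕ) where
  p : Y → ℝ → ℝ
  y : Fin n → Y
  a₁ : Fin n → EuclideanSpace ℝ (Fin k)
  b₁ : Fin n → ℝ
  a₂ : Fin n → EuclideanSpace ℝ (Fin k)
  b₂ : Fin n → ℝ
  m₀ : EuclideanSpace ℝ (Fin k)
  K₀ : Matrix (Fin k) (Fin k) ℝ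
  β : ℝ

namespace Model

variable {Y : Type*} {n k : ℕ} (D : Model Y n k)

/-- The mean `a_{i,1}ᵀ m + b_{i,1}` of `q(f_i | r)`. -/
def mean (i : Fin n) (r : Param k) : ℝ := (D.a₁ i).ofLp ⬝ᵥ r.m.ofLp + D.b₁ i

/-- The variance `a_{i,2}ᵀ V a_{i,2} + b_{i,2}` of `q(f_i | r)`. -/
def var (i : Fin n) (r : Param k) : ℝ := (D.a₂ i).ofLp ⬝ᵥ (r.V *ᵥ (D.a₂ i).ofLp) + D.b₂ i

/-- The marginal `q(f_i | r)`. -/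
def q (i : Fin n) (r : Param k) : Measure ℝ := gaussianReal (D.mean i r) (D.var i r).toNNReal

/-- The predictive expectation `E_{q(f_i | r)} p(y_i | f_i)`. -/
def predictive (i : Fin n) (r : Param k) : ℝ := ∫ f, D.p (D.y i) f ∂(D.q i r)

/-- `d_KL(q, p)` for `q = N(m, V)` and the prior `p = N(m₀, K₀)`. -/
def kl (r : Param k) : ℝ :=
  (InformationTheory.klDiv (multivariateGaussian r.m r.V)
    (multivariateGaussian D.m₀ D.K₀)).toReal

/-- The (scaled) log-loss DLM objective. -/
def objective (r : Param k) : ℝ :=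
  -(1 / (n : ℝ)) * (∑ i, Real.log (D.predictive i r)) + D.β / n * D.kl r

/-- The reparameterization `g_i(r, ε)`. -/
def g (i : Fin n) (r : Param k) (ε : ℝ) : ℝ := √(D.var i r) * ε + D.mean i r

/-- `φ_i(r, ε) = p(y_i | f_i = g_i(r, ε))`. -/
def φ (i : Fin n) (r : Param k) (ε : ℝ) : ℝ := D.p (D.y i) (D.g i r ε)

/-- `φ_i'(r, ε)`, the derivative of `p(y_i | f_i)` in `f_i` at `g_i(r, ε)`. -/
def φ' (i : Fin n) (r : Param k) (ε : ℝ) : ℝ := deriv (D.p (D.y i)) (D.g i r ε)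

/-- `φ_i''(r, ε)`, the second derivative of `p(y_i | f_i)` in `f_i` at `g_i(r, ε)`. -/
def φ'' (i : Fin n) (r : Param k) (ε : ℝ) : ℝ := deriv (deriv (D.p (D.y i))) (D.g i r ε)

/-- The likelihood and its first two derivatives in `f` exist and are bounded. -/
structure DerivativeBounds (B b' B' b'' B'' : ℝ) : Prop where
  differentiable : ∀ i, Differentiable ℝ (D.p (D.y i))
  differentiable_deriv : ∀ i, Differentiable ℝ (deriv (D.p (D.y i)))
  bound : ∀ i f, 0 ≤ D.p (D.y i) f ∧ D.p (D.y i) f ≤ B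
  bound' : ∀ i f, b' ≤ deriv (D.p (D.y i)) f ∧ deriv (D.p (D.y i)) f ≤ B'
  bound'' : ∀ i f, b'' ≤ deriv (deriv (D.p (D.y i))) f ∧ deriv (deriv (D.p (D.y i))) f ≤ B''

/-- The bMC direction for example `i` from the samples `ε 0, …, ε (L - 1)`: the pair
`(d_{i,m}, d_{i,V})`. -/
def exampleDirection (i : Fin n) (L : ℕ) (ε : ℕ → ℝ) (r : Param k) : Param k :=
  WithLp.toLp 2
    (((∑ l ∈ Finset.range L, D.φ' i r (ε l)) / ∑ l ∈ Finset.range L, D.φ i r (ε l)) • D.a₁ i,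
     ((∑ l ∈ Finset.range L, D.φ'' i r (ε l)) / ∑ l ∈ Finset.range L, D.φ i r (ε l)) •
        ((1 / 2 : ℝ) • outer (D.a₂ i)))

/-- The bMC step direction for the whole objective: Monte Carlo estimates for the loss terms and
the exact gradient of the KL term. -/
def bmcDirection (L : ℕ) (ε : Fin n → ℕ → ℝ) (r : Param k) : Param k :=
  (1 / (n : ℝ)) • (∑ i, D.exampleDirection i L (ε i) r) - (D.β / n) • ∇ D.kl r

/-- `|x|` if `x ≠ 0`, and `1` otherwise. -/
def absOrOne (x : ℝ) : ℝ := if x ≠ 0 then |x| else 1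

/-- The factor `M` of the sample size condition for example `i` at `r`; the expectations are over
`ε ∼ N(0, 1)`. -/
def sampleFactor (B b' B' b'' B'' : ℝ) (i : Fin n) (r : Param k) : ℝ :=
  max (B ^ 2 / |∫ ε, D.φ i r ε ∂(gaussianReal 0 1)| ^ 2)
    (max ((B' - b') ^ 2 / absOrOne (∫ ε, D.φ' i r ε ∂(gaussianReal 0 1)) ^ 2)
      ((B'' - b'') ^ 2 / absOrOne (∫ ε, D.φ'' i r ε ∂(gaussianReal 0 1)) ^ 2))

/-- The parameters at which all predictive expectations are at least `ζ`, all variances of the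
marginals `q(f_i | r)` are at least `lam` and, if the KL term is present, `V ⪰ lam • I`. -/
def domain (ζ lam : ℝ) : Set (Param k) :=
  {r | (∀ i, ζ ≤ D.predictive i r) ∧ (∀ i, lam ≤ D.var i r) ∧
    (0 < D.β → (r.V - lam • (1 : Matrix (Fin k) (Fin k) ℝ)).PosSemidef)}

end Model

/-- The conditions for convergence of the gradient method with errors
`r_{t+1} = r_t + γ_t d_t`, `d_t = s_t + w_t`, for the objective `h` on the set `S` of parameters
and with the constants `c₁, c₂, c₃, c₄` and Lipschitz constant `Λ`. -/
structure GradientMethodWithErrors {E : Type*} [NormedAddCommGroup E] [InnerProductSpace ℝ E]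
    [CompleteSpace E] (h : E → ℝ) (S : Set E) (γ : ℕ → ℝ) (r d : ℕ → E)
    (c₁ c₂ c₃ c₄ : ℝ) (Λ : ℝ≥0) : Prop where
  mem : ∀ t, r t ∈ S
  step : ∀ t, r (t + 1) = r t + γ t • d t
  decomposition : ∃ s w : ℕ → E, ∀ t, d t = s t + w t ∧
    c₁ * ‖∇ h (r t)‖ ^ 2 ≤ -inner ℝ (∇ h (r t)) (s t) ∧
    ‖s t‖ ≤ c₂ * ‖∇ h (r t)‖ ∧
    ‖w t‖ ≤ γ t * (c₃ + c₄ * ‖∇ h (r t)‖)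
  differentiable : ∀ x ∈ S, DifferentiableAt ℝ h x
  lipschitz : LipschitzOnWith Λ (∇ h) S
  summable_sq : Summable fun t => γ t ^ 2
  sum_tendsto : Tendsto (fun T => ∑ t ∈ Finset.range T, γ t) atTop atTop

/-- A run of bMC with step sizes `γ`, adapted sample sizes `L` and samples `ε t i l`. The iterate
`r t` and the sample size `L t` depend on the past only, and for each example `i` the samples of
step `t` are i.i.d. standard normal and independent of the past. -/
structure IsBMCRun {Y : Type*} {n k : ℕ} (D : Model Y n k) {Ω : Type*} {mΩ : MeasurableSpace Ω}
    (P : Measure Ω) (ℱ : Filtration ℕ mΩ) (γ : ℕ → ℝ) (L : ℕ → Ω → ℕ)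
    (ε : ℕ → Fin n → ℕ → Ω → ℝ) (r : ℕ → Ω → Param k) : Prop where
  adapted : StronglyAdapted ℱ r
  adapted_size : Adapted ℱ L
  measurable_sample : ∀ t i l, Measurable (ε t i l)
  law : ∀ t i l, HasLaw (ε t i l) (gaussianReal 0 1) P
  iIndep : ∀ t i, iIndepFun (fun l => ε t i l) P
  indep_past : ∀ t i, Indep (MeasurableSpace.comap (fun ω l => ε t i l ω) MeasurableSpace.pi)
    (ℱ t) P
  step : ∀ t ω, r (t + 1) ω =
    r t ω + γ t • D.bmcDirection (L t ω) (fun i l => ε t i l ω) (r t ω)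

end DLM

end

/-! For standard normal `ε`, Stein's identity makes `E ψ(√v ε + μ)` a function of `(μ, v)` whose
gradient is given by the expectations of `ψ'` and `ψ'' / 2`, Lipschitz for `v` bounded away from
`0`. Together with the closed form of the Gaussian KL divergence, this shows that `h` has a
Lipschitz gradient on `S` and that the bMC direction replaces the expectations in `-∇h` by sample
averages. Take `s_t = -∇h(r_t)`, so that `w_t` is the sampling error. Conditionally on the past,
Hoeffding's inequality and the size of `L_t` make all `3n` sample averages of step `t` accurate up
to a relative error `γ_t`, except with probability `δ_t`. For `γ_t < 1/2` this bounds `‖w_t‖` by a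
constant multiple of `γ_t`. In the finitely many other steps `‖d_t‖` is a finite random variable,
hence bounded outside an event of probability `δ_t`.

The descent inequality then gives convergence of `h(r_t)` and summability of `γ_t ‖∇h(r_t)‖²`.
As the gradient may move by `O(γ_t ‖∇h(r_t)‖)` in a step, that summability is best exploited for
`min(‖∇h(r_t)‖, 1)³`: its increments are summable, so it converges, and the limit is `0` since
`∑ γ_t = ∞`. -/

noncomputable section

namespace DLM

theorem lipschitzOnWith_smul {α E : Type*} [PseudoMetricSpace α] [SeminormedAddCommGroup E]
    [NormedSpace ℝ E] {S : Set α} {φ : α → ℝ} {F : α → E} {C C' M N : ℝ≥0}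
    (hφ : LipschitzOnWith C φ S) (hF : LipschitzOnWith C' F S) (hN : ∀ x ∈ S, |φ x| ≤ N)
    (hM : ∀ x ∈ S, ‖F x‖ ≤ M) :
    LipschitzOnWith (N * C' + C * M) (fun x => φ x • F x) S := by
  refine LipschitzOnWith.of_dist_le_mul fun y hy x hx => ?_
  calc dist (φ y • F y) (φ x • F x)
      = ‖φ y • (F y - F x) + (φ y - φ x) • F x‖ := by rw [dist_eq_norm, smul_sub, sub_smul]; abel_nf
    _ ≤ ‖φ y‖ * dist (F y) (F x) + dist (φ y) (φ x) * ‖F x‖ := by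
        rw [dist_eq_norm, dist_eq_norm, ← norm_smul, ← norm_smul]
        exact norm_add_le _ _
    _ ≤ N * (C' * dist y x) + C * dist y x * M := by
        gcongr
        exacts [hN y hy, hF.dist_le_mul y hy x hx, hφ.dist_le_mul y hy x hx, hM x hx]
    _ = (N * C' + C * M : ℝ≥0) * dist y x := by push_cast; ring

section LipschitzGradient

variable {E : Type*} [NormedAddCommGroup E] [InnerProductSpace ℝ E] {S T : Set E}
  {f g : E → ℝ} {F G : E → E} {C C' : ℝ≥0}

/-- On the set `S` the map `F` is a `C`-Lipschitz gradient of `f`. The quadratic bound on the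
remainder is a separate field because `S` need not be convex. -/
structure HasLipschitzGradientOn (C : ℝ≥0) (f : E → ℝ) (F : E → E) (S : Set E) : Prop where
  abs_sub_sub_inner_le : ∀ x ∈ S, ∀ y ∈ S, |f y - f x - inner ℝ (F x) (y - x)| ≤ C * ‖y - x‖ ^ 2
  lipschitz : LipschitzOnWith C F S

namespace HasLipschitzGradientOn

theorem mono (h : HasLipschitzGradientOn C f F T) (hST : S ⊆ T) : HasLipschitzGradientOn C f F S :=
  ⟨fun x hx y hy => h.abs_sub_sub_inner_le x (hST hx) y (hST hy), h.lipschitz.mono hST⟩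

theorem le_add_inner_add (h : HasLipschitzGradientOn C f F S) {x y : E} (hx : x ∈ S)
    (hy : y ∈ S) : f y ≤ f x + inner ℝ (F x) (y - x) + C * ‖y - x‖ ^ 2 := by
  linarith [(abs_le.1 (h.abs_sub_sub_inner_le x hx y hy)).2]

theorem congr (h : HasLipschitzGradientOn C f F S) (hgf : S.EqOn g f) :
    HasLipschitzGradientOn C g F S :=
  ⟨fun x hx y hy => by
    rw [hgf hx, hgf hy]
    exact h.abs_sub_sub_inner_le x hx y hy, h.lipschitz⟩

theorem zero : HasLipschitzGradientOn 0 (fun _ => 0) (fun _ => 0) S :=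
  ⟨by simp, fun x _ y _ => by simp⟩

theorem add (hf : HasLipschitzGradientOn C f F S) (hg : HasLipschitzGradientOn C' g G S) :
    HasLipschitzGradientOn (C + C') (fun x => f x + g x) (fun x => F x + G x) S := by
  refine ⟨fun x hx y hy => ?_, hf.lipschitz.add hg.lipschitz⟩
  calc |f y + g y - (f x + g x) - inner ℝ (F x + G x) (y - x)|
      = |(f y - f x - inner ℝ (F x) (y - x)) + (g y - g x - inner ℝ (G x) (y - x))| := by
        rw [inner_add_left]
        congr 1
        ring
    _ ≤ C * ‖y - x‖ ^ 2 + C' * ‖y - x‖ ^ 2 := (abs_add_le _ _).trans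
        (add_le_add (hf.abs_sub_sub_inner_le x hx y hy) (hg.abs_sub_sub_inner_le x hx y hy))
    _ = (C + C' : ℝ≥0) * ‖y - x‖ ^ 2 := by push_cast; ring

theorem const_mul (c : ℝ) (hf : HasLipschitzGradientOn C f F S) :
    HasLipschitzGradientOn (‖c‖₊ * C) (fun x => c * f x) (fun x => c • F x) S := by
  refine ⟨fun x hx y hy => ?_, (lipschitzWith_smul c).comp_lipschitzOnWith hf.lipschitz⟩
  rw [real_inner_smul_left, ← mul_sub, ← mul_sub, abs_mul, NNReal.coe_mul, coe_nnnorm,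
    Real.norm_eq_abs, mul_assoc]
  exact mul_le_mul_of_nonneg_left (hf.abs_sub_sub_inner_le x hx y hy) (abs_nonneg c)

theorem sum {ι : Type*} (s : Finset ι) {f : ι → E → ℝ} {F : ι → E → E} {C : ι → ℝ≥0}
    (h : ∀ i ∈ s, HasLipschitzGradientOn (C i) (f i) (F i) S) :
    HasLipschitzGradientOn (∑ i ∈ s, C i) (fun x => ∑ i ∈ s, f i x) (fun x => ∑ i ∈ s, F i x)
      S := by
  induction s using Finset.cons_induction with
  | empty => simpa using zero
  | cons a s ha ih =>
    simp only [Finset.sum_cons]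
    exact (h a (Finset.mem_cons_self a s)).add (ih fun i hi => h i (Finset.mem_cons_of_mem hi))

theorem comp {φ φ' : ℝ → ℝ} {I : Set ℝ} {K M N : ℝ≥0} (hφ : HasLipschitzGradientOn C' φ φ' I)
    (hf : HasLipschitzGradientOn C f F S) (hfI : Set.MapsTo f S I) (hfK : LipschitzOnWith K f S)
    (hN : ∀ t ∈ I, |φ' t| ≤ N) (hM : ∀ x ∈ S, ‖F x‖ ≤ M) :
    HasLipschitzGradientOn (C' * K * (K + M) + N * C) (fun x => φ (f x))
      (fun x => φ' (f x) • F x) S := by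
  have hfK' : ∀ x ∈ S, ∀ y ∈ S, |f y - f x| ≤ K * ‖y - x‖ := fun x hx y hy =>
    hfK.norm_sub_le hy hx
  refine ⟨fun x hx y hy => ?_, ?_⟩
  · have hsplit : φ (f y) - φ (f x) - inner ℝ (φ' (f x) • F x) (y - x) =
        (φ (f y) - φ (f x) - inner ℝ (φ' (f x)) (f y - f x)) +
          φ' (f x) * (f y - f x - inner ℝ (F x) (y - x)) := by
      rw [real_inner_smul_left, real_inner_eq_re_inner, RCLike.inner_apply]
      simp only [conj_trivial, RCLike.re_to_real]
      ring
    calc |φ (f y) - φ (f x) - inner ℝ (φ' (f x) • F x) (y - x)|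
        ≤ |φ (f y) - φ (f x) - inner ℝ (φ' (f x)) (f y - f x)| +
            |φ' (f x)| * |f y - f x - inner ℝ (F x) (y - x)| := by
          rw [hsplit, ← abs_mul]
          exact abs_add_le _ _
      _ ≤ C' * (K * ‖y - x‖) ^ 2 + N * (C * ‖y - x‖ ^ 2) := by
          refine add_le_add ((hφ.abs_sub_sub_inner_le _ (hfI hx) _ (hfI hy)).trans ?_) ?_
          · rw [Real.norm_eq_abs]
            gcongr
            exact hfK' x hx y hy
          · gcongr
            exacts [hN _ (hfI hx), hf.abs_sub_sub_inner_le x hx y hy]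
      _ = (C' * K * K + N * C) * ‖y - x‖ ^ 2 := by ring
      _ ≤ (C' * K * (K + M) + N * C : ℝ≥0) * ‖y - x‖ ^ 2 := by
          push_cast
          gcongr
          exact le_add_of_nonneg_right M.2
  · refine (lipschitzOnWith_smul (hφ.lipschitz.comp hfK hfI) hf.lipschitz
      (fun x hx => hN _ (hfI hx)) hM).weaken ?_
    rw [add_comm, mul_add]
    gcongr
    exact le_add_of_nonneg_left zero_le

theorem hasGradientAt [CompleteSpace E] {x : E} (h : HasLipschitzGradientOn C f F S)
    (hx : S ∈ 𝓝 x) : HasGradientAt f (F x) x := by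
  rw [hasGradientAt_iff_isLittleO]
  have hquad : (fun y => f y - f x - inner ℝ (F x) (y - x)) =O[𝓝 x] fun y => ‖y - x‖ ^ 2 := by
    refine Asymptotics.IsBigO.of_bound C ?_
    filter_upwards [hx] with y hy
    simpa using h.abs_sub_sub_inner_le x (mem_of_mem_nhds hx) y hy
  have hnorm : Tendsto (fun y : E => ‖y - x‖) (𝓝 x) (𝓝 0) :=
    tendsto_iff_norm_sub_tendsto_zero.1 tendsto_id
  exact hquad.trans_isLittleO
    ((Asymptotics.isLittleO_pow_id (𝕜 := ℝ) one_lt_two).comp_tendsto hnorm).of_norm_right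

theorem gradient [CompleteSpace E] (h : HasLipschitzGradientOn C f F S)
    (hF : ∀ x ∈ S, HasGradientAt f (F x) x) : HasLipschitzGradientOn C f (∇ f) S := by
  have hgradient : ∀ x ∈ S, ∇ f x = F x := fun x hx => (hF x hx).gradient
  refine ⟨fun x hx y hy => ?_, fun x hx y hy => ?_⟩
  · rw [hgradient x hx]
    exact h.abs_sub_sub_inner_le x hx y hy
  · rw [hgradient x hx, hgradient y hy]
    exact h.lipschitz hx hy

end HasLipschitzGradientOn

theorem abs_log_sub_log_sub_le {ζ a b : ℝ} (hζ : 0 < ζ) (ha : ζ ≤ a) (hb : ζ ≤ b) :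
    |Real.log b - Real.log a - a⁻¹ * (b - a)| ≤ (ζ ^ 2)⁻¹ * (b - a) ^ 2 := by
  have ha₀ := hζ.trans_le ha
  have hb₀ := hζ.trans_le hb
  have tangent : ∀ {x y : ℝ}, 0 < x → 0 < y → Real.log y - Real.log x ≤ x⁻¹ * (y - x) := by
    intro x y hx hy
    rw [← Real.log_div hy.ne' hx.ne']
    exact (Real.log_le_sub_one_of_pos (by positivity)).trans_eq (by field_simp)
  have hgap : a⁻¹ * (b - a) - b⁻¹ * (b - a) = (a * b)⁻¹ * (b - a) ^ 2 := by
    field_simp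
  have hbound : (a * b)⁻¹ * (b - a) ^ 2 ≤ (ζ ^ 2)⁻¹ * (b - a) ^ 2 := by
    gcongr
    nlinarith
  have hnonneg : 0 ≤ (ζ ^ 2)⁻¹ * (b - a) ^ 2 := by positivity
  rw [abs_le]
  constructor <;> linarith [tangent ha₀ hb₀, tangent hb₀ ha₀]

theorem hasLipschitzGradientOn_log {ζ : ℝ≥0} (hζ : 0 < ζ) :
    HasLipschitzGradientOn (ζ ^ 2)⁻¹ Real.log (·⁻¹) (Set.Ici (ζ : ℝ)) := by
  have hζ' : (0 : ℝ) < ζ := hζ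
  refine ⟨fun a ha b hb => ?_, lipschitzOnWith_iff_norm_sub_le.2 fun b hb a ha => ?_⟩
  · simpa [mul_comm] using abs_log_sub_log_sub_le hζ' ha hb
  · have ha₀ := hζ'.trans_le ha
    have hb₀ := hζ'.trans_le hb
    have hinv : b⁻¹ - a⁻¹ = (b * a)⁻¹ * (a - b) := by field_simp
    rw [hinv, norm_mul, norm_sub_rev, norm_inv, Real.norm_of_nonneg (by positivity)]
    push_cast
    gcongr
    rw [pow_two]
    exact mul_le_mul hb ha hζ'.le hb₀.le

end LipschitzGradient

section GradientMethod

theorem tendsto_zero_of_summable_sq {γ : ℕ → ℝ} (h : Summable fun t => γ t ^ 2) :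
    Tendsto γ atTop (𝓝 0) := by
  rw [tendsto_zero_iff_abs_tendsto_zero]
  simpa [Function.comp_def, Real.sqrt_sq_eq_abs] using h.tendsto_atTop_zero.sqrt

theorem tendsto_and_summable_of_le_sub_add {H a b : ℕ → ℝ} {m : ℝ} (ha : ∀ t, 0 ≤ a t)
    (hb : Summable b) (hH : ∀ t, H (t + 1) ≤ H t - a t + b t) (hm : ∀ t, m ≤ H t) :
    (∃ l, Tendsto H atTop (𝓝 l)) ∧ Summable a := by
  obtain ⟨β, hβ⟩ := hb.hasSum.tendsto_sum_nat.bddAbove_range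
  replace hβ : ∀ t, ∑ s ∈ Finset.range t, b s ≤ β := fun t => hβ ⟨t, rfl⟩
  constructor
  · have hanti : Antitone fun t => H t - ∑ s ∈ Finset.range t, b s := by
      refine antitone_nat_of_succ_le fun t => ?_
      rw [Finset.sum_range_succ]
      linarith [hH t, ha t]
    have hbdd : BddBelow (Set.range fun t => H t - ∑ s ∈ Finset.range t, b s) :=
      ⟨m - β, Set.forall_mem_range.2 fun t => sub_le_sub (hm t) (hβ t)⟩
    exact ⟨_, ((tendsto_atTop_ciInf hanti hbdd).add hb.hasSum.tendsto_sum_nat).congr fun t =>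
      sub_add_cancel _ _⟩
  · have hsum : ∀ t, ∑ s ∈ Finset.range t, a s ≤ H 0 - H t + ∑ s ∈ Finset.range t, b s := by
      intro t
      induction t with
      | zero => simp
      | succ t ih =>
        rw [Finset.sum_range_succ, Finset.sum_range_succ]
        linarith [hH t]
    exact summable_of_sum_range_le (c := H 0 - m + β) ha fun t => by
      linarith [hsum t, hm t, hβ t]

theorem tendsto_and_summable_of_descent {H g γ : ℕ → ℝ} {A c m : ℝ} (hc : 0 < c)
    (hγ : ∀ t, 0 ≤ γ t) (hγ_sq : Summable fun t => γ t ^ 2)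
    (hH : ∀ t, H (t + 1) ≤ H t - c * (γ t * g t ^ 2) + γ t ^ 2 * (A * (1 + g t ^ 2)))
    (hm : ∀ t, m ≤ H t) :
    (∃ l, Tendsto H atTop (𝓝 l)) ∧ Summable fun t => γ t * g t ^ 2 := by
  have hγA : Tendsto (fun t => γ t * A) atTop (𝓝 0) := by
    simpa using (tendsto_zero_of_summable_sq hγ_sq).mul_const A
  obtain ⟨T, hT⟩ := (hγA.eventually (ge_mem_nhds (half_pos hc))).exists_forall_of_atTop
  have hdescent : ∀ t, H (t + 1 + T) ≤
      H (t + T) - c / 2 * (γ (t + T) * g (t + T) ^ 2) + γ (t + T) ^ 2 * A := by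
    intro t
    have habsorb := mul_le_mul_of_nonneg_right (hT (t + T) (by omega))
      (mul_nonneg (hγ (t + T)) (sq_nonneg (g (t + T))))
    have hdecrease := hH (t + T)
    rw [add_right_comm t T 1] at hdecrease
    linarith
  obtain ⟨⟨l, hl⟩, hsum⟩ := tendsto_and_summable_of_le_sub_add
    (fun t => by have := hγ (t + T); positivity)
    (((summable_nat_add_iff T).2 hγ_sq).mul_right A) hdescent fun t => hm (t + T)
  rw [summable_mul_left_iff (half_pos hc).ne'] at hsum
  exact ⟨⟨l, (tendsto_add_atTop_iff_nat T).1 hl⟩,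
    (summable_nat_add_iff (f := fun t => γ t * g t ^ 2) T).1 hsum⟩

theorem abs_pow_three_sub_le {u v : ℝ} (hu : u ∈ Set.Icc 0 1) (hv : v ∈ Set.Icc 0 1) :
    |v ^ 3 - u ^ 3| ≤ 3 * |v - u| * (u ^ 2 + |v - u|) := by
  have hvu : v ≤ u + |v - u| := by linarith [le_abs_self (v - u)]
  have hd := abs_nonneg (v - u)
  have hprod : v * u ≤ u ^ 2 + |v - u| := by nlinarith [hu.1, hu.2]
  have hsq : v ^ 2 ≤ v * u + |v - u| := by nlinarith [hv.1, hv.2]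
  rw [show v ^ 3 - u ^ 3 = (v - u) * (v ^ 2 + v * u + u ^ 2) by ring, abs_mul, mul_comm 3,
    mul_assoc]
  gcongr
  have : 0 ≤ v * u := mul_nonneg hv.1 hu.1
  rw [abs_of_nonneg (by positivity)]
  linarith

-- The truncated cube is flat at `0` and constant beyond `1`, so that increments of `x` of order
-- `c * (1 + x)` are turned into increments of order `c * x ^ 2 + c ^ 2`, which are summable.
theorem abs_min_one_pow_three_sub_le {x y c : ℝ} (hx : 0 ≤ x) (hy : 0 ≤ y)
    (h : |y - x| ≤ c * (1 + x)) :
    |min y 1 ^ 3 - min x 1 ^ 3| ≤ 12 * (c * x ^ 2 + c ^ 2) := by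
  have hmem : ∀ {z : ℝ}, 0 ≤ z → min z 1 ∈ Set.Icc 0 1 := fun hz =>
    ⟨le_min hz zero_le_one, min_le_right _ _⟩
  have hcube := abs_pow_three_sub_le (hmem hx) (hmem hy)
  have hd := abs_nonneg (min y 1 - min x 1)
  have hdc : |min y 1 - min x 1| ≤ c * (1 + x) :=
    (by simpa using abs_min_sub_min_le_max y 1 x 1 : _ ≤ |y - x|).trans h
  have hc : 0 ≤ c := nonneg_of_mul_nonneg_left ((abs_nonneg _).trans h) (by linarith)
  rcases le_total x 1 with hx₁ | hx₁
  · have hd₂ : |min y 1 - min x 1| ≤ 2 * c := hdc.trans (by nlinarith)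
    calc _ ≤ 3 * (2 * c) * (x ^ 2 + 2 * c) := by
          rw [min_eq_left hx₁] at hcube hd₂ ⊢
          exact hcube.trans (by gcongr)
      _ ≤ 12 * (c * x ^ 2 + c ^ 2) := by nlinarith [mul_nonneg hc (sq_nonneg x)]
  · have hd₁ : |min y 1 - min x 1| ≤ 1 := by
      rw [abs_le]
      constructor <;> linarith [(hmem hx).1, (hmem hx).2, (hmem hy).1, (hmem hy).2]
    calc _ ≤ 3 * (c * (1 + x)) * (1 + 1) := by
          simp only [min_eq_right hx₁, one_pow] at hcube hd₁ hdc ⊢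
          exact hcube.trans (by gcongr)
      _ ≤ 12 * (c * x ^ 2 + c ^ 2) := by nlinarith [mul_nonneg hc (sub_nonneg.2 hx₁)]

theorem not_summable_of_tendsto_atTop {γ : ℕ → ℝ}
    (h : Tendsto (fun T => ∑ t ∈ Finset.range T, γ t) atTop atTop) : ¬ Summable γ := fun hγ =>
  not_tendsto_nhds_of_tendsto_atTop h _ hγ.hasSum.tendsto_sum_nat

theorem eq_zero_of_summable_mul_of_tendsto {γ u : ℕ → ℝ} {l : ℝ} (hγ : ∀ t, 0 ≤ γ t)
    (hγ_sum : Tendsto (fun T => ∑ t ∈ Finset.range T, γ t) atTop atTop)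
    (hs : Summable fun t => γ t * u t) (hu : Tendsto u atTop (𝓝 l)) (hl : 0 ≤ l) : l = 0 := by
  by_contra hne
  have hpos : 0 < l := lt_of_le_of_ne hl (Ne.symm hne)
  obtain ⟨T, hT⟩ := (hu.eventually (lt_mem_nhds (half_lt_self hpos))).exists_forall_of_atTop
  refine not_summable_of_tendsto_atTop hγ_sum ((summable_nat_add_iff T).1 ?_)
  refine Summable.of_nonneg_of_le (fun t => hγ _) (fun t => ?_)
    (((summable_nat_add_iff T).2 hs).mul_left (2 / l))
  calc γ (t + T) = 2 / l * (γ (t + T) * (l / 2)) := by field_simp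
    _ ≤ 2 / l * (γ (t + T) * u (t + T)) := by
        have := hγ (t + T)
        gcongr
        exact (hT (t + T) (by omega)).le

theorem tendsto_zero_of_summable_mul_sq {g γ : ℕ → ℝ} {A : ℝ} (hg : ∀ t, 0 ≤ g t)
    (hγ : ∀ t, 0 ≤ γ t) (hγ_sum : Tendsto (fun T => ∑ t ∈ Finset.range T, γ t) atTop atTop)
    (hγ_sq : Summable fun t => γ t ^ 2) (hs : Summable fun t => γ t * g t ^ 2)
    (hstep : ∀ t, |g (t + 1) - g t| ≤ A * γ t * (1 + g t)) :
    Tendsto g atTop (𝓝 0) := by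
  have hmin : ∀ t, 0 ≤ min (g t) 1 := fun t => le_min (hg t) zero_le_one
  have hcauchy : CauchySeq fun t => min (g t) 1 ^ 3 := by
    refine cauchySeq_of_dist_le_of_summable _ (fun t => ?_)
      (((hs.mul_left A).add (hγ_sq.mul_left (A ^ 2))).mul_left 12)
    rw [dist_comm, Real.dist_eq]
    exact (abs_min_one_pow_three_sub_le (hg t) (hg _) (hstep t)).trans_eq (by ring)
  obtain ⟨l, hl⟩ := cauchySeq_tendsto_of_complete hcauchy
  have hs' : Summable fun t => γ t * min (g t) 1 ^ 3 := by
    refine hs.of_nonneg_of_le (fun t => mul_nonneg (hγ t) (pow_nonneg (hmin t) 3)) fun t => ?_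
    have hle : min (g t) 1 ^ 3 ≤ g t ^ 2 :=
      (pow_le_pow_of_le_one (hmin t) (min_le_right _ _) (by norm_num)).trans
        (pow_le_pow_left₀ (hmin t) (min_le_left _ _) 2)
    exact mul_le_mul_of_nonneg_left hle (hγ t)
  obtain rfl := eq_zero_of_summable_mul_of_tendsto hγ hγ_sum hs' hl
    (ge_of_tendsto' hl fun t => pow_nonneg (hmin t) 3)
  have hmin_zero : Tendsto (fun t => min (g t) 1) atTop (𝓝 0) := by
    simpa only [Real.pow_rpow_inv_natCast (hmin _) three_ne_zero,
      Real.zero_rpow (inv_ne_zero (Nat.cast_ne_zero.2 three_ne_zero))] using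
      hl.rpow_const (p := ((3 : ℕ) : ℝ)⁻¹) (Or.inr (by positivity))
  refine hmin_zero.congr' ?_
  filter_upwards [hmin_zero.eventually (gt_mem_nhds one_pos)] with t ht
  exact min_eq_left (le_of_not_ge fun h => ht.not_ge (le_min h le_rfl))

namespace GradientMethodWithErrors

variable {E : Type*} [NormedAddCommGroup E] [InnerProductSpace ℝ E] [CompleteSpace E]
  {h : E → ℝ} {S : Set E} {γ : ℕ → ℝ} {r d : ℕ → E} {c₁ c₂ c₃ c₄ : ℝ} {Λ : ℝ≥0}

theorem inner_gradient_direction_le (H : GradientMethodWithErrors h S γ r d c₁ c₂ c₃ c₄ Λ)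
    (hγ : ∀ t, 0 ≤ γ t) (t : ℕ) :
    inner ℝ (∇ h (r t)) (d t) ≤
      -c₁ * ‖∇ h (r t)‖ ^ 2 + γ t * (2 * (|c₃| + |c₄|) * (1 + ‖∇ h (r t)‖ ^ 2)) := by
  obtain ⟨s, w, hsw⟩ := H.decomposition
  obtain ⟨hd, hs, -, hw⟩ := hsw t
  set g := ‖∇ h (r t)‖
  have : 0 ≤ g := norm_nonneg _
  have hγt := hγ t
  have hinner : inner ℝ (∇ h (r t)) (w t) ≤ g * (γ t * (|c₃| + |c₄| * g)) := by
    refine (real_inner_le_norm _ _).trans ?_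
    gcongr
    refine hw.trans ?_
    gcongr <;> exact le_abs_self _
  have hquad : g * (|c₃| + |c₄| * g) ≤ 2 * (|c₃| + |c₄|) * (1 + g ^ 2) := by
    nlinarith [mul_nonneg (abs_nonneg c₃) (sq_nonneg (1 - g)), abs_nonneg c₃, abs_nonneg c₄,
      mul_nonneg (abs_nonneg c₃) (sq_nonneg g), mul_nonneg (abs_nonneg c₄) (sq_nonneg g)]
  rw [hd, inner_add_right]
  nlinarith [mul_le_mul_of_nonneg_left hquad hγt]

theorem exists_norm_direction_le (H : GradientMethodWithErrors h S γ r d c₁ c₂ c₃ c₄ Λ)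
    (hγ : ∀ t, 0 ≤ γ t) : ∃ K, 0 ≤ K ∧ ∀ t, ‖d t‖ ≤ K * (1 + ‖∇ h (r t)‖) := by
  obtain ⟨s, w, hsw⟩ := H.decomposition
  obtain ⟨Γ, hΓ⟩ := (tendsto_zero_of_summable_sq H.summable_sq).bddAbove_range
  replace hΓ : ∀ t, γ t ≤ Γ := fun t => hΓ ⟨t, rfl⟩
  have hΓ₀ : 0 ≤ Γ := (hγ 0).trans (hΓ 0)
  refine ⟨|c₂| + Γ * (|c₃| + |c₄|), by positivity, fun t => ?_⟩
  obtain ⟨hd, -, hs, hw⟩ := hsw t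
  set g := ‖∇ h (r t)‖
  have hg : 0 ≤ g := norm_nonneg _
  calc ‖d t‖ ≤ c₂ * g + γ t * (c₃ + c₄ * g) := by
        rw [hd]
        exact (norm_add_le _ _).trans (add_le_add hs hw)
    _ ≤ |c₂| * (1 + g) + Γ * ((|c₃| + |c₄|) * (1 + g)) := by
        have hsum : c₃ + c₄ * g ≤ (|c₃| + |c₄|) * (1 + g) := by
          nlinarith [le_abs_self c₃, mul_le_mul_of_nonneg_right (le_abs_self c₄) hg,
            abs_nonneg c₄, mul_nonneg (abs_nonneg c₃) hg]
        gcongr ?_ + ?_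
        · exact mul_le_mul (le_abs_self _) (by linarith) hg (abs_nonneg _)
        · exact (mul_le_mul_of_nonneg_left hsum (hγ t)).trans (by gcongr; exact hΓ t)
    _ = (|c₂| + Γ * (|c₃| + |c₄|)) * (1 + g) := by ring

-- Proposition 1 of Bertsekas and Tsitsiklis (2000). Since the domain need not be convex, the upper
-- bound `hquad` does not follow from the Lipschitz condition.
theorem tendsto (H : GradientMethodWithErrors h S γ r d c₁ c₂ c₃ c₄ Λ) (hc₁ : 0 < c₁)
    (hγ : ∀ t, 0 ≤ γ t) {C : ℝ≥0} {m : ℝ}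
    (hquad : ∀ t, h (r (t + 1)) ≤
      h (r t) + inner ℝ (∇ h (r t)) (r (t + 1) - r t) + C * ‖r (t + 1) - r t‖ ^ 2)
    (hm : ∀ t, m ≤ h (r t)) :
    (∃ l, Tendsto (fun t => h (r t)) atTop (𝓝 l)) ∧
      Tendsto (fun t => ∇ h (r t)) atTop (𝓝 0) := by
  obtain ⟨K, _, hd⟩ := H.exists_norm_direction_le hγ
  have hdiff : ∀ t, r (t + 1) - r t = γ t • d t := fun t => by rw [H.step t, add_sub_cancel_left]
  have hnorm : ∀ t, ‖r (t + 1) - r t‖ ≤ γ t * (K * (1 + ‖∇ h (r t)‖)) := fun t => by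
    rw [hdiff, norm_smul, Real.norm_of_nonneg (hγ t)]
    exact mul_le_mul_of_nonneg_left (hd t) (hγ t)
  have hdescent : ∀ t, h (r (t + 1)) ≤ h (r t) - c₁ * (γ t * ‖∇ h (r t)‖ ^ 2) +
      γ t ^ 2 * ((2 * (|c₃| + |c₄|) + 2 * C * K ^ 2) * (1 + ‖∇ h (r t)‖ ^ 2)) := by
    intro t
    have hlinear : inner ℝ (∇ h (r t)) (r (t + 1) - r t) ≤ γ t * (-c₁ * ‖∇ h (r t)‖ ^ 2 +
        γ t * (2 * (|c₃| + |c₄|) * (1 + ‖∇ h (r t)‖ ^ 2))) := by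
      rw [hdiff, inner_smul_right]
      exact mul_le_mul_of_nonneg_left (H.inner_gradient_direction_le hγ t) (hγ t)
    have hsq : ‖r (t + 1) - r t‖ ^ 2 ≤ γ t ^ 2 * (K ^ 2 * (2 * (1 + ‖∇ h (r t)‖ ^ 2))) := by
      calc ‖r (t + 1) - r t‖ ^ 2 ≤ (γ t * (K * (1 + ‖∇ h (r t)‖))) ^ 2 := by
            gcongr
            exact hnorm t
        _ = γ t ^ 2 * (K ^ 2 * (1 + ‖∇ h (r t)‖) ^ 2) := by ring
        _ ≤ _ := by
            gcongr
            nlinarith [sq_nonneg (1 - ‖∇ h (r t)‖)]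
    nlinarith [hquad t, mul_le_mul_of_nonneg_left hsq C.coe_nonneg]
  have hvariation : ∀ t, |‖∇ h (r (t + 1))‖ - ‖∇ h (r t)‖| ≤
      (Λ * K) * γ t * (1 + ‖∇ h (r t)‖) := fun t =>
    calc _ ≤ ‖∇ h (r (t + 1)) - ∇ h (r t)‖ := abs_norm_sub_norm_le _ _
      _ ≤ Λ * ‖r (t + 1) - r t‖ := H.lipschitz.norm_sub_le (H.mem _) (H.mem _)
      _ ≤ Λ * (γ t * (K * (1 + ‖∇ h (r t)‖))) := by gcongr; exact hnorm t
      _ = _ := by ring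
  obtain ⟨hconv, hsum⟩ := tendsto_and_summable_of_descent hc₁ hγ H.summable_sq hdescent hm
  exact ⟨hconv, tendsto_zero_iff_norm_tendsto_zero.2 <| tendsto_zero_of_summable_mul_sq
    (fun t => norm_nonneg _) hγ H.sum_tendsto H.summable_sq hsum hvariation⟩

end GradientMethodWithErrors

end GradientMethod

section GaussianSmoothing

theorem integrable_gaussianReal_iff {μ : ℝ} {v : ℝ≥0} (hv : v ≠ 0) {f : ℝ → ℝ} :
    Integrable f (gaussianReal μ v) ↔ Integrable fun x => f x * gaussianPDFReal μ v x := by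
  rw [gaussianReal_of_var_ne_zero μ hv, integrable_withDensity_iff (measurable_gaussianPDF μ v)
    (ae_of_all _ fun _ => gaussianPDF_lt_top)]
  simp only [toReal_gaussianPDF]

theorem hasDerivAt_gaussianPDFReal (μ : ℝ) (v : ℝ≥0) (x : ℝ) :
    HasDerivAt (gaussianPDFReal μ v) (-((x - μ) / v) * gaussianPDFReal μ v x) x := by
  have hexponent : HasDerivAt (fun x => -(x - μ) ^ 2 / (2 * v)) (-((x - μ) / v)) x := by
    convert! (((hasDerivAt_id x).sub_const μ).pow 2).neg.div_const (2 * (v : ℝ)) using 1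
    simp only [id_eq]
    field_simp
    ring
  rw [gaussianPDFReal_def]
  convert! hexponent.exp.const_mul _ using 1
  ring

theorem integral_mul_sub_gaussianReal {μ : ℝ} {v : ℝ≥0} {u u' : ℝ → ℝ}
    (hu : ∀ x, HasDerivAt u (u' x) x) (hui : Integrable u (gaussianReal μ v))
    (hu_mul : Integrable (fun x => u x * (x - μ)) (gaussianReal μ v))
    (hu' : Integrable u' (gaussianReal μ v)) :
    ∫ x, u x * (x - μ) ∂(gaussianReal μ v) = v * ∫ x, u' x ∂(gaussianReal μ v) := by
  rcases eq_or_ne v 0 with rfl | hv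
  · simp [gaussianReal_zero_var]
  have hv' : (v : ℝ) ≠ 0 := NNReal.coe_ne_zero.2 hv
  rw [integrable_gaussianReal_iff hv] at hui hu_mul hu'
  have hpdf : ∀ x, -(v : ℝ)⁻¹ * (u x * (x - μ) * gaussianPDFReal μ v x) =
      u x * (-((x - μ) / v) * gaussianPDFReal μ v x) := fun x => by field_simp
  have hparts := integral_mul_deriv_eq_deriv_mul_of_integrable (fun x _ => hu x)
    (fun x _ => hasDerivAt_gaussianPDFReal μ v x)
    ((hu_mul.const_mul (-(v : ℝ)⁻¹)).congr (ae_of_all _ hpdf)) hu' hui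
  simp_rw [← hpdf, integral_const_mul] at hparts
  simp_rw [integral_gaussianReal_eq_integral_smul hv, smul_eq_mul, mul_comm (gaussianPDFReal μ v _)]
  field_simp at hparts ⊢
  linarith

theorem integrable_id_stdGaussianReal : Integrable (fun ε : ℝ => ε) (gaussianReal 0 1) :=
  (memLp_id_gaussianReal 1).integrable le_rfl

theorem integrable_sq_stdGaussianReal : Integrable (fun ε : ℝ => ε ^ 2) (gaussianReal 0 1) :=
  (memLp_id_gaussianReal 2).integrable_sq

theorem integral_sq_stdGaussianReal : ∫ ε, ε ^ 2 ∂(gaussianReal 0 1) = 1 := by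
  have h := variance_fun_id_gaussianReal (μ := 0) (v := 1)
  rw [variance_of_integral_eq_zero (by fun_prop) (by simp)] at h
  simpa using h

theorem integral_abs_stdGaussianReal_le : ∫ ε, |ε| ∂(gaussianReal 0 1) ≤ 1 := by
  calc ∫ ε, |ε| ∂(gaussianReal 0 1)
      ≤ ∫ ε, (1 / 2 + 1 / 2 * ε ^ 2) ∂(gaussianReal 0 1) := by
        refine integral_mono integrable_id_stdGaussianReal.abs
          ((integrable_const _).add (integrable_sq_stdGaussianReal.const_mul _)) fun ε => ?_
        simp only
        nlinarith [sq_abs ε, sq_nonneg (1 - |ε|)]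
    _ = 1 := by
        rw [integral_add (integrable_const _) (integrable_sq_stdGaussianReal.const_mul _),
          integral_const_mul, integral_sq_stdGaussianReal]
        norm_num

/-- The expectation of `ψ` under `N(μ, v)`, through the reparameterization `√v ε + μ`. -/
def smooth (ψ : ℝ → ℝ) (μ v : ℝ) : ℝ := ∫ ε, ψ (√v * ε + μ) ∂(gaussianReal 0 1)

theorem integral_gaussianReal_eq_smooth {ψ : ℝ → ℝ} (hψ : Measurable ψ) (μ : ℝ) {v : ℝ}
    (hv : 0 ≤ v) : ∫ f, ψ f ∂(gaussianReal μ v.toNNReal) = smooth ψ μ v := by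
  have hmap : (gaussianReal 0 1).map (fun ε => √v * ε + μ) = gaussianReal μ v.toNNReal := by
    rw [← Function.comp_def (· + μ), ← Measure.map_map (by fun_prop) (by fun_prop),
      gaussianReal_map_const_mul, gaussianReal_map_add_const]
    congr 1
    · simp
    · ext
      simp [Real.sq_sqrt hv, hv]
  rw [← hmap, integral_map (by fun_prop) hψ.aestronglyMeasurable, smooth]

section CompAffine

variable {ψ : ℝ → ℝ} {K M : ℝ≥0}

theorem integrable_comp_affine_mul {ν : Measure ℝ} {w : ℝ → ℝ} (hψ : Measurable ψ)
    (hM : ∀ x, |ψ x| ≤ M) (hw : Integrable w ν) (σ μ : ℝ) :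
    Integrable (fun ε => ψ (σ * ε + μ) * w ε) ν :=
  hw.bdd_mul (hψ.comp (by fun_prop)).aestronglyMeasurable (ae_of_all _ fun _ => hM _)

theorem integrable_comp_affine {ν : Measure ℝ} [IsFiniteMeasure ν] (hψ : Measurable ψ)
    (hM : ∀ x, |ψ x| ≤ M) (σ μ : ℝ) : Integrable (fun ε => ψ (σ * ε + μ)) ν := by
  simpa using integrable_comp_affine_mul hψ hM (integrable_const (1 : ℝ)) σ μ

theorem abs_integral_comp_affine_mul_sub_le {ν : Measure ℝ} {w : ℝ → ℝ} (hψ : LipschitzWith K ψ)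
    (hM : ∀ x, |ψ x| ≤ M) (hw : Integrable w ν) (hw' : Integrable (fun ε => ε * w ε) ν)
    (σ σ' μ μ' : ℝ) :
    |∫ ε, ψ (σ' * ε + μ') * w ε ∂ν - ∫ ε, ψ (σ * ε + μ) * w ε ∂ν| ≤
      K * (|σ' - σ| * ∫ ε, |ε * w ε| ∂ν + |μ' - μ| * ∫ ε, |w ε| ∂ν) := by
  have hi := integrable_comp_affine_mul hψ.continuous.measurable hM hw
  have hpoint : ∀ ε, ‖ψ (σ' * ε + μ') * w ε - ψ (σ * ε + μ) * w ε‖ ≤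
      K * (|σ' - σ| * |ε * w ε| + |μ' - μ| * |w ε|) := fun ε =>
    calc ‖ψ (σ' * ε + μ') * w ε - ψ (σ * ε + μ) * w ε‖
        = |ψ (σ' * ε + μ') - ψ (σ * ε + μ)| * |w ε| := by rw [← sub_mul, Real.norm_eq_abs, abs_mul]
      _ ≤ K * |(σ' * ε + μ') - (σ * ε + μ)| * |w ε| := by
          gcongr
          exact hψ.norm_sub_le _ _
      _ = K * |(σ' - σ) * ε + (μ' - μ)| * |w ε| := by congr 3; ring
      _ ≤ K * (|σ' - σ| * |ε| + |μ' - μ|) * |w ε| := by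
          gcongr
          exact (abs_add_le _ _).trans_eq (by rw [abs_mul])
      _ = _ := by rw [abs_mul]; ring
  rw [← integral_sub (hi _ _) (hi _ _), ← integral_const_mul, ← integral_const_mul,
    ← integral_add (hw'.abs.const_mul _) (hw.abs.const_mul _), ← integral_const_mul]
  exact norm_integral_le_of_norm_le
    (by exact ((hw'.abs.const_mul _).add (hw.abs.const_mul _)).const_mul _) (ae_of_all _ hpoint)

theorem integral_comp_affine_mul_id (hψ : Differentiable ℝ ψ) (hM : ∀ x, |ψ x| ≤ M)
    (hM' : ∀ x, |deriv ψ x| ≤ K) (σ μ : ℝ) :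
    ∫ ε, ψ (σ * ε + μ) * ε ∂(gaussianReal 0 1) =
      σ * ∫ ε, deriv ψ (σ * ε + μ) ∂(gaussianReal 0 1) := by
  have hmeas := hψ.continuous.measurable
  have hderiv : ∀ x, HasDerivAt (fun ε => ψ (σ * ε + μ)) (σ * deriv ψ (σ * x + μ)) x := fun x => by
    simpa [mul_comm, Function.comp_def] using
      (hψ _).hasDerivAt.comp x (((hasDerivAt_id x).const_mul σ).add_const μ)
  have hstein := integral_mul_sub_gaussianReal (μ := 0) (v := 1) hderiv
    (integrable_comp_affine hmeas hM σ μ)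
    (by simpa using integrable_comp_affine_mul hmeas hM integrable_id_stdGaussianReal σ μ)
    ((integrable_comp_affine (measurable_deriv ψ) hM' σ μ).const_mul σ)
  simpa [integral_const_mul] using hstein

theorem abs_smooth_le (hM : ∀ x, |ψ x| ≤ M) (μ v : ℝ) : |smooth ψ μ v| ≤ M := by
  simpa [smooth] using norm_integral_le_of_norm_le_const (μ := gaussianReal 0 1)
    (f := fun ε => ψ (√v * ε + μ)) (ae_of_all _ fun ε => hM _)

theorem abs_smooth_sub_le (hψ : LipschitzWith K ψ) (hM : ∀ x, |ψ x| ≤ M) (μ v μ' v' : ℝ) :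
    |smooth ψ μ' v' - smooth ψ μ v| ≤ K * (|√v' - √v| + |μ' - μ|) := by
  have h := abs_integral_comp_affine_mul_sub_le (ν := gaussianReal 0 1) hψ hM
    (integrable_const (1 : ℝ)) (by simpa using integrable_id_stdGaussianReal) (√v) (√v') μ μ'
  simp only [mul_one, abs_one, integral_const, probReal_univ, smul_eq_mul] at h
  refine h.trans ?_
  gcongr
  exact mul_le_of_le_one_right (abs_nonneg _) integral_abs_stdGaussianReal_le

theorem sqrt_mul_abs_smooth_deriv_sub_le (hψ : Differentiable ℝ ψ) (hM : ∀ x, |ψ x| ≤ M)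
    (hM' : ∀ x, |deriv ψ x| ≤ K) (μ v μ' v' : ℝ) :
    √v' * |smooth (deriv ψ) μ' v' - smooth (deriv ψ) μ v| ≤
      2 * K * (|√v' - √v| + |μ' - μ|) := by
  have hweighted := abs_integral_comp_affine_mul_sub_le (ν := gaussianReal 0 1)
    (lipschitzWith_of_nnnorm_deriv_le hψ hM') hM integrable_id_stdGaussianReal
    (by simpa only [sq] using integrable_sq_stdGaussianReal) (√v) (√v') μ μ'
  simp only [integral_comp_affine_mul_id hψ hM hM', ← sq, abs_sq, integral_sq_stdGaussianReal,
    mul_one] at hweighted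
  change |√v' * smooth (deriv ψ) μ' v' - √v * smooth (deriv ψ) μ v| ≤ _ at hweighted
  calc √v' * |smooth (deriv ψ) μ' v' - smooth (deriv ψ) μ v|
      = |(√v' * smooth (deriv ψ) μ' v' - √v * smooth (deriv ψ) μ v) -
          (√v' - √v) * smooth (deriv ψ) μ v| := by
        rw [← abs_of_nonneg (Real.sqrt_nonneg v'), ← abs_mul, abs_of_nonneg (Real.sqrt_nonneg v')]
        congr 1
        ring
    _ ≤ K * (|√v' - √v| + |μ' - μ|) + |√v' - √v| * K := by
        refine (abs_sub _ _).trans (add_le_add (hweighted.trans ?_) ?_)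
        · gcongr
          exact mul_le_of_le_one_right (abs_nonneg _) integral_abs_stdGaussianReal_le
        · rw [abs_mul]
          gcongr
          exact abs_smooth_le hM' μ v
    _ ≤ 2 * K * (|√v' - √v| + |μ' - μ|) := by
        nlinarith [mul_nonneg K.coe_nonneg (abs_nonneg (μ' - μ))]

end CompAffine

theorem abs_sub_sub_deriv_mul_le {ψ : ℝ → ℝ} {M : ℝ≥0} (hψ : Differentiable ℝ ψ)
    (hψ' : LipschitzWith M (deriv ψ)) (x y : ℝ) :
    |ψ y - ψ x - deriv ψ x * (y - x)| ≤ M * (y - x) ^ 2 := by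
  have hderiv : ∀ z, HasDerivAt (fun z => ψ z - deriv ψ x * z) (deriv ψ z - deriv ψ x) z :=
    fun z => (hψ z).hasDerivAt.sub (by simpa using (hasDerivAt_id z).const_mul (deriv ψ x))
  have hbound : ∀ z ∈ Set.uIcc x y, ‖deriv ψ z - deriv ψ x‖ ≤ M * |y - x| := fun z hz =>
    (hψ'.norm_sub_le z x).trans (by gcongr; exact Set.abs_sub_left_of_mem_uIcc hz)
  calc |ψ y - ψ x - deriv ψ x * (y - x)|
      = ‖ψ y - deriv ψ x * y - (ψ x - deriv ψ x * x)‖ := by rw [Real.norm_eq_abs]; congr 1; ring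
    _ ≤ M * |y - x| * ‖y - x‖ := (convex_uIcc x y).norm_image_sub_le_of_norm_hasDerivWithin_le
        (fun z _ => (hderiv z).hasDerivWithinAt) hbound Set.left_mem_uIcc Set.right_mem_uIcc
    _ = M * (y - x) ^ 2 := by rw [Real.norm_eq_abs, mul_assoc, abs_mul_abs_self, sq]

/-- `ψ` is twice differentiable, and `M` bounds `ψ` and its first two derivatives. -/
structure BoundedDerivs (M : ℝ≥0) (ψ : ℝ → ℝ) : Prop where
  differentiable : Differentiable ℝ ψ
  differentiable_deriv : Differentiable ℝ (deriv ψ)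
  abs_le : ∀ x, |ψ x| ≤ M
  abs_deriv_le : ∀ x, |deriv ψ x| ≤ M
  abs_deriv_deriv_le : ∀ x, |deriv (deriv ψ) x| ≤ M

namespace BoundedDerivs

variable {ψ : ℝ → ℝ} {M : ℝ≥0}

theorem lipschitzWith (hψ : BoundedDerivs M ψ) : LipschitzWith M ψ :=
  lipschitzWith_of_nnnorm_deriv_le hψ.differentiable hψ.abs_deriv_le

theorem lipschitzWith_deriv (hψ : BoundedDerivs M ψ) : LipschitzWith M (deriv ψ) :=
  lipschitzWith_of_nnnorm_deriv_le hψ.differentiable_deriv hψ.abs_deriv_deriv_le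

theorem abs_smooth_sub_sub_sqrt_le (hψ : BoundedDerivs M ψ) (μ v μ' v' : ℝ) :
    |smooth ψ μ' v' - smooth ψ μ v - ((√v' - √v) * (√v * smooth (deriv (deriv ψ)) μ v) +
      (μ' - μ) * smooth (deriv ψ) μ v)| ≤ M * ((√v' - √v) ^ 2 + (μ' - μ) ^ 2) := by
  set ν := gaussianReal 0 1
  have hψi := integrable_comp_affine (ν := ν) hψ.differentiable.continuous.measurable hψ.abs_le
  have hψ'_meas := hψ.differentiable_deriv.continuous.measurable
  have hψ'i := integrable_comp_affine (ν := ν) hψ'_meas hψ.abs_deriv_le (√v) μ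
  have hψ'_mul := integrable_comp_affine_mul hψ'_meas hψ.abs_deriv_le
    integrable_id_stdGaussianReal (√v) μ
  have hlinear : (√v' - √v) * (√v * smooth (deriv (deriv ψ)) μ v) +
      (μ' - μ) * smooth (deriv ψ) μ v =
      ∫ ε, ((√v' - √v) * (deriv ψ (√v * ε + μ) * ε) + (μ' - μ) * deriv ψ (√v * ε + μ)) ∂ν := by
    rw [integral_add (hψ'_mul.const_mul _) (hψ'i.const_mul _), integral_const_mul,
      integral_const_mul, integral_comp_affine_mul_id hψ.differentiable_deriv hψ.abs_deriv_le
        hψ.abs_deriv_deriv_le, smooth, smooth]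
  have hbound : ∀ ε, ‖ψ (√v' * ε + μ') - ψ (√v * ε + μ) -
      ((√v' - √v) * (deriv ψ (√v * ε + μ) * ε) + (μ' - μ) * deriv ψ (√v * ε + μ))‖ ≤
      M * ((√v' - √v) ^ 2 * ε ^ 2 + 2 * (√v' - √v) * (μ' - μ) * ε + (μ' - μ) ^ 2) := fun ε => by
    convert! abs_sub_sub_deriv_mul_le hψ.differentiable hψ.lipschitzWith_deriv (√v * ε + μ)
      (√v' * ε + μ') using 1
    · rw [Real.norm_eq_abs]
      congr 1
      ring
    · ring
  have hsq := integrable_sq_stdGaussianReal.const_mul ((√v' - √v) ^ 2)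
  have hid := integrable_id_stdGaussianReal.const_mul (2 * (√v' - √v) * (μ' - μ))
  rw [hlinear, smooth, smooth, ← integral_sub (hψi _ _) (hψi _ _), ← integral_sub
    (by exact (hψi _ _).sub (hψi _ _)) (by exact (hψ'_mul.const_mul _).add (hψ'i.const_mul _))]
  refine (norm_integral_le_of_norm_le (by exact
    ((hsq.add hid).add (integrable_const _)).const_mul _) (ae_of_all _ hbound)).trans_eq ?_
  rw [integral_const_mul, integral_add (by exact hsq.add hid) (integrable_const _),
    integral_add hsq hid, integral_const_mul, integral_const_mul, integral_sq_stdGaussianReal,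
    integral_id_gaussianReal]
  simp [ν]

theorem abs_smooth_sub_sub_le (hψ : BoundedDerivs M ψ) {μ v μ' v' : ℝ} (hv : 0 ≤ v)
    (hv' : 0 ≤ v') :
    |smooth ψ μ' v' - smooth ψ μ v - (smooth (deriv ψ) μ v * (μ' - μ) +
      smooth (deriv (deriv ψ)) μ v * (1 / 2 * (v' - v)))| ≤
      2 * M * ((√v' - √v) ^ 2 + (μ' - μ) ^ 2) := by
  have hsplit : smooth ψ μ' v' - smooth ψ μ v - (smooth (deriv ψ) μ v * (μ' - μ) +
      smooth (deriv (deriv ψ)) μ v * (1 / 2 * (v' - v))) =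
      (smooth ψ μ' v' - smooth ψ μ v - ((√v' - √v) * (√v * smooth (deriv (deriv ψ)) μ v) +
        (μ' - μ) * smooth (deriv ψ) μ v)) -
        1 / 2 * (√v' - √v) ^ 2 * smooth (deriv (deriv ψ)) μ v := by
    linear_combination (1 / 2 * smooth (deriv (deriv ψ)) μ v) * (Real.sq_sqrt hv' - Real.sq_sqrt hv)
  calc _ ≤ M * ((√v' - √v) ^ 2 + (μ' - μ) ^ 2) + 1 / 2 * (√v' - √v) ^ 2 * M := by
        rw [hsplit]
        refine (abs_sub _ _).trans (add_le_add (hψ.abs_smooth_sub_sub_sqrt_le μ v μ' v') ?_)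
        rw [abs_mul, abs_of_nonneg (by positivity : 0 ≤ 1 / 2 * (√v' - √v) ^ 2)]
        gcongr
        exact abs_smooth_le hψ.abs_deriv_deriv_le μ v
    _ ≤ 2 * M * ((√v' - √v) ^ 2 + (μ' - μ) ^ 2) := by
        nlinarith [mul_nonneg M.coe_nonneg (sq_nonneg (√v' - √v)),
          mul_nonneg M.coe_nonneg (sq_nonneg (μ' - μ))]

end BoundedDerivs

section Composition

variable {α : Type*} [PseudoMetricSpace α] {S : Set α} {μ v : α → ℝ} {ψ : ℝ → ℝ}
  {Cμ Cσ K M : ℝ≥0}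

theorem lipschitzOnWith_sqrt {C lam : ℝ≥0} (hv : LipschitzOnWith C v S) (hlam : 0 < lam)
    (h : ∀ x ∈ S, lam ≤ v x) :
    LipschitzOnWith (C / NNReal.sqrt lam) (fun x => √(v x)) S := by
  have hpos : 0 < √(lam : ℝ) := Real.sqrt_pos.2 hlam
  refine LipschitzOnWith.of_dist_le_mul fun y hy x hx => ?_
  have hx' := Real.sqrt_le_sqrt (h x hx)
  have hy' := Real.sqrt_le_sqrt (h y hy)
  have hdiff : v y - v x = (√(v y) - √(v x)) * (√(v y) + √(v x)) := by
    linear_combination -Real.sq_sqrt (lam.2.trans (h y hy)) + Real.sq_sqrt (lam.2.trans (h x hx))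
  rw [NNReal.coe_div, Real.coe_sqrt, div_mul_eq_mul_div, le_div_iff₀ hpos]
  refine le_trans ?_ (hv.dist_le_mul y hy x hx)
  rw [Real.dist_eq, Real.dist_eq, hdiff, abs_mul, abs_of_pos (by linarith : 0 < √(v y) + √(v x))]
  gcongr
  linarith

theorem lipschitzOnWith_smooth (hμ : LipschitzOnWith Cμ μ S)
    (hσ : LipschitzOnWith Cσ (fun x => √(v x)) S) (hψ : LipschitzWith K ψ)
    (hM : ∀ x, |ψ x| ≤ M) :
    LipschitzOnWith (K * (Cσ + Cμ)) (fun x => smooth ψ (μ x) (v x)) S := by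
  refine LipschitzOnWith.of_dist_le_mul fun y hy x hx => ?_
  calc dist (smooth ψ (μ y) (v y)) (smooth ψ (μ x) (v x))
      ≤ K * (dist (√(v y)) (√(v x)) + dist (μ y) (μ x)) := abs_smooth_sub_le hψ hM _ _ _ _
    _ ≤ K * (Cσ * dist y x + Cμ * dist y x) := by
        gcongr
        exacts [hσ.dist_le_mul y hy x hx, hμ.dist_le_mul y hy x hx]
    _ = _ := by push_cast; ring

theorem lipschitzOnWith_smooth_deriv {lam : ℝ≥0} (hμ : LipschitzOnWith Cμ μ S)
    (hσ : LipschitzOnWith Cσ (fun x => √(v x)) S) (hlam : 0 < lam) (hv : ∀ x ∈ S, lam ≤ v x)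
    (hψ : Differentiable ℝ ψ) (hM : ∀ x, |ψ x| ≤ M) (hM' : ∀ x, |deriv ψ x| ≤ K) :
    LipschitzOnWith (2 * K * (Cσ + Cμ) / NNReal.sqrt lam)
      (fun x => smooth (deriv ψ) (μ x) (v x)) S := by
  refine LipschitzOnWith.of_dist_le_mul fun y hy x hx => ?_
  rw [NNReal.coe_div, Real.coe_sqrt, div_mul_eq_mul_div]
  refine (le_div_iff₀' (Real.sqrt_pos.2 hlam)).2 ?_
  calc √lam * dist (smooth (deriv ψ) (μ y) (v y)) (smooth (deriv ψ) (μ x) (v x))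
      ≤ √(v y) * dist (smooth (deriv ψ) (μ y) (v y)) (smooth (deriv ψ) (μ x) (v x)) := by
        gcongr
        exact hv y hy
    _ ≤ 2 * K * (dist (√(v y)) (√(v x)) + dist (μ y) (μ x)) :=
        sqrt_mul_abs_smooth_deriv_sub_le hψ hM hM' _ _ _ _
    _ ≤ 2 * K * (Cσ * dist y x + Cμ * dist y x) := by
        gcongr
        exacts [hσ.dist_le_mul y hy x hx, hμ.dist_le_mul y hy x hx]
    _ = _ := by push_cast; ring

end Composition

section Affine

variable {E : Type*} [NormedAddCommGroup E] [InnerProductSpace ℝ E] {μ v : E → ℝ} {a b : E}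
  {ψ : ℝ → ℝ} {M lam : ℝ≥0}

theorem lipschitzWith_of_sub_eq_inner (h : ∀ x y, μ y - μ x = inner ℝ a (y - x)) :
    LipschitzWith ‖a‖₊ μ :=
  LipschitzWith.of_dist_le_mul fun y x => by
    rw [Real.dist_eq, h, dist_eq_norm]
    exact abs_real_inner_le_norm a (y - x)

theorem exists_lipschitzOnWith_smooth (hψ : BoundedDerivs M ψ)
    (hμ : ∀ x y, μ y - μ x = inner ℝ a (y - x)) (hv : ∀ x y, v y - v x = inner ℝ b (y - x))
    (hlam : 0 < lam) :
    ∃ C, LipschitzOnWith C (fun x => smooth ψ (μ x) (v x)) {x | lam ≤ v x} :=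
  ⟨_, lipschitzOnWith_smooth (lipschitzWith_of_sub_eq_inner hμ).lipschitzOnWith
    (lipschitzOnWith_sqrt (lipschitzWith_of_sub_eq_inner hv).lipschitzOnWith hlam fun _ hx => hx)
    hψ.lipschitzWith hψ.abs_le⟩

theorem exists_hasLipschitzGradientOn_smooth (hψ : BoundedDerivs M ψ)
    (hμ : ∀ x y, μ y - μ x = inner ℝ a (y - x)) (hv : ∀ x y, v y - v x = inner ℝ b (y - x))
    (hlam : 0 < lam) :
    ∃ C, HasLipschitzGradientOn C (fun x => smooth ψ (μ x) (v x))
      (fun x => smooth (deriv ψ) (μ x) (v x) • a +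
        smooth (deriv (deriv ψ)) (μ x) (v x) • (1 / 2 : ℝ) • b) {x | lam ≤ v x} := by
  have hμL := (lipschitzWith_of_sub_eq_inner hμ).lipschitzOnWith (s := {x | lam ≤ v x})
  have hσL := lipschitzOnWith_sqrt (lipschitzWith_of_sub_eq_inner hv).lipschitzOnWith hlam
    fun _ hx => hx
  have hgrad := (lipschitzOnWith_smul (lipschitzOnWith_smooth hμL hσL hψ.lipschitzWith_deriv
      hψ.abs_deriv_le) (LipschitzWith.const a).lipschitzOnWith
      (fun _ _ => abs_smooth_le hψ.abs_deriv_le _ _) (fun _ _ => (coe_nnnorm a).ge)).add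
    (lipschitzOnWith_smul (lipschitzOnWith_smooth_deriv hμL hσL hlam (fun _ hx => hx)
      hψ.differentiable_deriv hψ.abs_deriv_le hψ.abs_deriv_deriv_le)
      (LipschitzWith.const ((1 / 2 : ℝ) • b)).lipschitzOnWith
      (fun _ _ => abs_smooth_le hψ.abs_deriv_deriv_le _ _) (fun _ _ => (coe_nnnorm _).ge))
  have hquad : ∀ x ∈ {x | lam ≤ v x}, ∀ y ∈ {x | lam ≤ v x},
      |smooth ψ (μ y) (v y) - smooth ψ (μ x) (v x) - inner ℝ (smooth (deriv ψ) (μ x) (v x) • a +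
        smooth (deriv (deriv ψ)) (μ x) (v x) • (1 / 2 : ℝ) • b) (y - x)| ≤
      2 * M * ((√(v y) - √(v x)) ^ 2 + (μ y - μ x) ^ 2) := fun x hx y hy => by
    simp only [inner_add_left, real_inner_smul_left, ← hμ, ← hv]
    exact hψ.abs_smooth_sub_sub_le (lam.2.trans hx) (lam.2.trans hy)
  refine ⟨_ + 2 * M * ((‖b‖₊ / NNReal.sqrt lam) ^ 2 + ‖a‖₊ ^ 2), fun x hx y hy => ?_,
    hgrad.weaken le_self_add⟩
  calc _ ≤ 2 * M * ((√(v y) - √(v x)) ^ 2 + (μ y - μ x) ^ 2) := hquad x hx y hy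
    _ = 2 * M * (dist (√(v y)) (√(v x)) ^ 2 + dist (μ y) (μ x) ^ 2) := by
        simp only [Real.dist_eq, sq_abs]
    _ ≤ 2 * M * ((‖b‖₊ / NNReal.sqrt lam * ‖y - x‖) ^ 2 + (‖a‖₊ * ‖y - x‖) ^ 2) := by
        rw [← dist_eq_norm]
        gcongr
        exacts [hσL.dist_le_mul y hy x hx, hμL.dist_le_mul y hy x hx]
    _ = (2 * M * ((‖b‖₊ / NNReal.sqrt lam) ^ 2 + ‖a‖₊ ^ 2) : ℝ≥0) * ‖y - x‖ ^ 2 := by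
        push_cast
        ring
    _ ≤ _ := by
        gcongr
        exact le_add_self

end Affine

end GaussianSmoothing

section GaussianDensity

theorem toReal_klDiv_withDensity_exp {α : Type*} {mα : MeasurableSpace α} {ρ : Measure α}
    [SigmaFinite ρ] {f g : α → ℝ} (hf : Measurable f) (hg : Measurable g)
    [IsProbabilityMeasure (ρ.withDensity fun x => ENNReal.ofReal (Real.exp (f x)))]
    [IsProbabilityMeasure (ρ.withDensity fun x => ENNReal.ofReal (Real.exp (g x)))] :
    (InformationTheory.klDiv (ρ.withDensity fun x => ENNReal.ofReal (Real.exp (f x)))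
      (ρ.withDensity fun x => ENNReal.ofReal (Real.exp (g x)))).toReal =
      ∫ x, f x - g x ∂(ρ.withDensity fun x => ENNReal.ofReal (Real.exp (f x))) := by
  set μ := ρ.withDensity fun x => ENNReal.ofReal (Real.exp (f x))
  set ν := ρ.withDensity fun x => ENNReal.ofReal (Real.exp (g x))
  have hμρ : μ ≪ ρ := withDensity_absolutelyContinuous _ _
  have hpos : ∀ x, ENNReal.ofReal (Real.exp (g x)) ≠ 0 := fun x => by simp [Real.exp_pos]
  have hρν : ρ ≪ ν :=
    withDensity_absolutelyContinuous' (by fun_prop) (ae_of_all _ hpos)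
  have hdens : μ.rnDeriv ρ =ᵐ[ρ] fun x => ENNReal.ofReal (Real.exp (f x)) :=
    Measure.rnDeriv_withDensity _ (by fun_prop)
  have hratio : μ.rnDeriv ν =ᵐ[ρ] fun x =>
      (ENNReal.ofReal (Real.exp (g x)))⁻¹ * μ.rnDeriv ρ x :=
    Measure.rnDeriv_withDensity_right _ _ (by fun_prop) (ae_of_all _ hpos)
      (ae_of_all _ fun _ => ENNReal.ofReal_ne_top)
  have hllr : llr μ ν =ᵐ[μ] fun x => f x - g x := by
    filter_upwards [hμρ.ae_le hdens, hμρ.ae_le hratio] with x hx hx'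
    rw [llr, hx', hx, ← ENNReal.ofReal_inv_of_pos (Real.exp_pos _),
      ← ENNReal.ofReal_mul (by positivity), ENNReal.toReal_ofReal (by positivity), ← Real.exp_neg,
      ← Real.exp_add, Real.log_exp, neg_add_eq_sub]
  rw [InformationTheory.toReal_klDiv_of_measure_eq (hμρ.trans hρν) (by simp),
    integral_congr_ae hllr]

section Standard

variable {E : Type*} [NormedAddCommGroup E] [InnerProductSpace ℝ E] [FiniteDimensional ℝ E]
  [MeasurableSpace E] [BorelSpace E]

theorem integrable_exp_sub_norm_sq_div_two (c : ℝ) :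
    Integrable (fun x : E => Real.exp (c - ‖x‖ ^ 2 / 2)) := by
  have h := (GaussianFourier.integrable_cexp_neg_mul_sq_norm_add (V := E)
    (b := (1 / 2 : ℂ)) (by norm_num) 0 0).norm.const_mul (Real.exp c)
  refine h.congr (ae_of_all _ fun x => ?_)
  have hexp : -(1 / 2 : ℂ) * ‖x‖ ^ 2 + 0 * (inner ℝ (0 : E) x : ℝ) =
      ((-(‖x‖ ^ 2 / 2) : ℝ) : ℂ) := by
    push_cast
    ring
  simp only [Complex.norm_exp, hexp, Complex.ofReal_re, ← Real.exp_add, sub_eq_add_neg]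

theorem stdGaussian_eq_withDensity : stdGaussian E = volume.withDensity fun x =>
    ENNReal.ofReal (Real.exp
      (-(Module.finrank ℝ E / 2 * Real.log (2 * Real.pi)) - ‖x‖ ^ 2 / 2)) := by
  set c : ℝ := -(Module.finrank ℝ E / 2 * Real.log (2 * Real.pi)) with hc
  have : IsFiniteMeasure ((volume : Measure E).withDensity
      fun x => ENNReal.ofReal (Real.exp (c - ‖x‖ ^ 2 / 2))) :=
    isFiniteMeasure_withDensity_ofReal (integrable_exp_sub_norm_sq_div_two c).2
  have hnormalization :
      Complex.exp c * ((Real.pi : ℂ) / (1 / 2)) ^ ((Module.finrank ℝ E : ℂ) / 2) = 1 := by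
    rw [show ((Real.pi : ℂ) / (1 / 2)) = ((2 * Real.pi : ℝ) : ℂ) by push_cast; ring,
      show ((Module.finrank ℝ E : ℂ) / 2) = ((Module.finrank ℝ E / 2 : ℝ) : ℂ) by push_cast; rfl,
      ← Complex.ofReal_cpow (by positivity), Real.rpow_def_of_pos (by positivity),
      ← Complex.ofReal_exp, ← Complex.ofReal_mul, ← Real.exp_add, hc, mul_comm (Real.log _),
      neg_add_cancel, Real.exp_zero, Complex.ofReal_one]
  refine Measure.ext_of_charFun (funext fun t => ?_)
  have hintegrand : ∀ x : E,
      (ENNReal.ofReal (Real.exp (c - ‖x‖ ^ 2 / 2))).toReal • Complex.exp (inner ℝ x t * Complex.I) =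
        Complex.exp c *
          Complex.exp (-(1 / 2 : ℂ) * ‖x‖ ^ 2 + Complex.I * inner ℝ t x) := fun x => by
    rw [ENNReal.toReal_ofReal (Real.exp_pos _).le, Complex.real_smul, Complex.ofReal_exp,
      ← Complex.exp_add, ← Complex.exp_add, real_inner_comm]
    push_cast
    ring_nf
  rw [charFun_stdGaussian, charFun_apply, integral_withDensity_eq_integral_toReal_smul
    (by fun_prop) (ae_of_all _ fun _ => ENNReal.ofReal_lt_top)]
  simp_rw [hintegrand]
  rw [integral_const_mul, GaussianFourier.integral_cexp_neg_mul_sq_norm_add (by norm_num),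
    ← mul_assoc, hnormalization, one_mul, Complex.I_sq]
  ring_nf

end Standard

variable {ι : Type*} [Fintype ι]

/-- The Frobenius inner product of two matrices. -/
def frobeniusInner (A B : Matrix ι ι ℝ) : ℝ := ∑ i, ∑ j, A i j * B i j

theorem dotProduct_mulVec_eq_sum (A : Matrix ι ι ℝ) (x : ι → ℝ) :
    x ⬝ᵥ (A *ᵥ x) = ∑ i, ∑ j, A i j * (x i * x j) := by
  simp only [dotProduct, Matrix.mulVec, Finset.mul_sum]
  exact Finset.sum_congr rfl fun i _ => Finset.sum_congr rfl fun j _ => by ring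

variable [DecidableEq ι]

theorem map_add_toEuclideanCLM_withDensity {R : Matrix ι ι ℝ} (hR : R.det ≠ 0)
    (m : EuclideanSpace ℝ ι) {f : EuclideanSpace ℝ ι → ℝ≥0∞} (hf : Measurable f) :
    (volume.withDensity f).map (fun x => m + Matrix.toEuclideanCLM (𝕜 := ℝ) R x) =
      volume.withDensity fun y =>
        ENNReal.ofReal |R.det⁻¹| * f (Matrix.toEuclideanCLM (𝕜 := ℝ) R⁻¹ (y - m)) := by
  set T := Matrix.toEuclideanCLM (n := ι) (𝕜 := ℝ)
  have hinv : ∀ x, T R⁻¹ (m + T R x - m) = x := fun x => by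
    rw [add_sub_cancel_left, ← mul_apply_eq_comp, ← map_mul,
      Matrix.nonsing_inv_mul _ (isUnit_iff_ne_zero.2 hR), map_one, one_apply_eq_self]
  have hdet : LinearMap.det (T R : EuclideanSpace ℝ ι →ₗ[ℝ] EuclideanSpace ℝ ι) = R.det :=
    LinearMap.det_toLpLin 2 R
  have hvolume : volume.map (fun x => m + T R x) = ENNReal.ofReal |R.det⁻¹| • volume :=
    calc volume.map (fun x => m + T R x)
        = (volume.map (T R : EuclideanSpace ℝ ι →ₗ[ℝ] EuclideanSpace ℝ ι)).map (m + ·) :=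
          (Measure.map_map (measurable_const_add m) (T R).measurable).symm
      _ = ENNReal.ofReal |R.det⁻¹| • volume := by
          rw [Measure.map_linearMap_addHaar_eq_smul_addHaar _ (hdet ▸ hR), hdet, Measure.map_smul,
            map_add_left_eq_self]
  refine Measure.ext_of_lintegral _ fun φ hφ => ?_
  have hfT : Measurable fun y => f (T R⁻¹ (y - m)) := by fun_prop
  calc ∫⁻ y, φ y ∂(volume.withDensity f).map (fun x => m + T R x)
      = ∫⁻ x, f (T R⁻¹ (m + T R x - m)) * φ (m + T R x) := by
        rw [lintegral_map hφ (by fun_prop), lintegral_withDensity_eq_lintegral_mul _ hf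
          (by fun_prop)]
        simp only [hinv, Pi.mul_apply]
    _ = ∫⁻ y, f (T R⁻¹ (y - m)) * φ y ∂volume.map (fun x => m + T R x) :=
        (lintegral_map (hfT.mul hφ) (by fun_prop)).symm
    _ = _ := by
        rw [hvolume, lintegral_smul_measure, lintegral_withDensity_eq_lintegral_mul _
          (hfT.const_mul _) hφ, smul_eq_mul, ← lintegral_const_mul _ (by fun_prop)]
        simp only [Pi.mul_apply, mul_assoc]

/-- The logarithm of the Lebesgue density of `N(m, V)`, for positive definite `V`. -/
def gaussianLogDensity (m : EuclideanSpace ℝ ι) (V : Matrix ι ι ℝ) (x : EuclideanSpace ℝ ι) : ℝ :=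
  -(Fintype.card ι / 2 * Real.log (2 * Real.pi)) - 1 / 2 * Real.log V.det -
    1 / 2 * ((x - m).ofLp ⬝ᵥ (V⁻¹ *ᵥ (x - m).ofLp))

@[fun_prop]
theorem continuous_gaussianLogDensity (m : EuclideanSpace ℝ ι) (V : Matrix ι ι ℝ) :
    Continuous (gaussianLogDensity m V) := by
  unfold gaussianLogDensity
  fun_prop

theorem norm_sq_toEuclideanCLM_inv {R : Matrix ι ι ℝ} (hR : R.IsHermitian)
    (x : EuclideanSpace ℝ ι) :
    ‖Matrix.toEuclideanCLM (𝕜 := ℝ) R⁻¹ x‖ ^ 2 = x.ofLp ⬝ᵥ ((R * R)⁻¹ *ᵥ x.ofLp) := by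
  have hRinv : (R⁻¹)ᵀ = R⁻¹ := by simpa using hR.inv.eq
  rw [Matrix.mul_inv_rev, ← Matrix.mulVec_mulVec, Matrix.dotProduct_mulVec,
    ← Matrix.mulVec_transpose, hRinv, EuclideanSpace.real_norm_sq_eq, dotProduct]
  simp only [Matrix.ofLp_toEuclideanCLM, sq]

open scoped MatrixOrder in
theorem multivariateGaussian_eq_withDensity (m : EuclideanSpace ℝ ι) {V : Matrix ι ι ℝ}
    (hV : V.PosDef) : multivariateGaussian m V = volume.withDensity fun x =>
      ENNReal.ofReal (Real.exp (gaussianLogDensity m V x)) := by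
  set R : Matrix ι ι ℝ := CFC.sqrt V
  have hRR : R * R = V := CFC.sqrt_mul_sqrt_self V hV.posSemidef.nonneg
  have hRsymm : R.IsHermitian := (CFC.sqrt_nonneg V).isSelfAdjoint
  have hdetV : R.det ^ 2 = V.det := by rw [← hRR, Matrix.det_mul, sq]
  have hdet : R.det ≠ 0 := fun h => by simpa [h] using hdetV.trans_ne hV.det_pos.ne'
  have habs : |R.det⁻¹| = Real.exp (-(1 / 2 * Real.log V.det)) := by
    rw [← hdetV, Real.log_pow, abs_inv, ← Real.exp_log (abs_pos.2 hdet), Real.log_abs,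
      ← Real.exp_neg]
    ring_nf
  change (stdGaussian (EuclideanSpace ℝ ι)).map _ = _
  rw [stdGaussian_eq_withDensity, map_add_toEuclideanCLM_withDensity hdet m (by fun_prop)]
  congr with y
  rw [← ENNReal.ofReal_mul (abs_nonneg _), habs, ← Real.exp_add, gaussianLogDensity,
    norm_sq_toEuclideanCLM_inv hRsymm, hRR, finrank_euclideanSpace]
  ring_nf

section Moments

variable (m a : EuclideanSpace ℝ ι) (V : Matrix ι ι ℝ)

theorem memLp_sub_multivariateGaussian (i : ι) :
    MemLp (fun x => x i - a i) 2 (multivariateGaussian m V) :=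
  ((EuclideanSpace.proj (𝕜 := ℝ) i).comp_memLp' IsGaussian.memLp_two_id).sub (memLp_const _)

theorem integral_sub_multivariateGaussian (i : ι) :
    ∫ x, x i - a i ∂(multivariateGaussian m V) = m i - a i := by
  have hmean := (EuclideanSpace.proj i : EuclideanSpace ℝ ι →L[ℝ] ℝ).integral_comp_id_comm
    (μ := multivariateGaussian m V) IsGaussian.integrable_id
  rw [integral_id_multivariateGaussian] at hmean
  have hi : Integrable (fun x => x i) (multivariateGaussian m V) :=
    (EuclideanSpace.proj i : EuclideanSpace ℝ ι →L[ℝ] ℝ).integrable_comp IsGaussian.integrable_id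
  rw [integral_sub hi (integrable_const _)]
  simpa using hmean

variable {V}

theorem integral_mul_sub_multivariateGaussian (hV : V.PosSemidef) (i j : ι) :
    ∫ x, (x i - a i) * (x j - a j) ∂(multivariateGaussian m V) =
      V i j + (m i - a i) * (m j - a j) := by
  have hcov := covariance_eq_sub (memLp_sub_multivariateGaussian m a V i)
    (memLp_sub_multivariateGaussian m a V j)
  have hint : ∀ i, Integrable (fun x => x i) (multivariateGaussian m V) := fun i =>
    (EuclideanSpace.proj i : EuclideanSpace ℝ ι →L[ℝ] ℝ).integrable_comp IsGaussian.integrable_id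
  rw [covariance_sub_const_left (hint i), covariance_sub_const_right (hint j),
    covariance_eval_multivariateGaussian hV, integral_sub_multivariateGaussian,
    integral_sub_multivariateGaussian] at hcov
  simp only [Pi.mul_apply] at hcov
  linear_combination -hcov

end Moments

theorem integrable_quadratic_multivariateGaussian (m a : EuclideanSpace ℝ ι)
    (V A : Matrix ι ι ℝ) :
    Integrable (fun x => (x - a).ofLp ⬝ᵥ (A *ᵥ (x - a).ofLp)) (multivariateGaussian m V) := by
  simp only [dotProduct_mulVec_eq_sum]
  exact integrable_finsetSum _ fun i _ => integrable_finsetSum _ fun j _ =>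
    ((memLp_sub_multivariateGaussian m a V i).integrable_mul
      (memLp_sub_multivariateGaussian m a V j)).const_mul _

theorem integral_quadratic_multivariateGaussian (m a : EuclideanSpace ℝ ι)
    {V : Matrix ι ι ℝ} (hV : V.PosSemidef) (A : Matrix ι ι ℝ) :
    ∫ x, (x - a).ofLp ⬝ᵥ (A *ᵥ (x - a).ofLp) ∂(multivariateGaussian m V) =
      frobeniusInner A V + (m - a).ofLp ⬝ᵥ (A *ᵥ (m - a).ofLp) := by
  have hint : ∀ i j, Integrable (fun x : EuclideanSpace ℝ ι =>
      A i j * ((x i - a i) * (x j - a j))) (multivariateGaussian m V) := fun i j =>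
    ((memLp_sub_multivariateGaussian m a V i).integrable_mul
      (memLp_sub_multivariateGaussian m a V j)).const_mul _
  simp only [dotProduct_mulVec_eq_sum, PiLp.sub_apply, frobeniusInner, ← Finset.sum_add_distrib]
  rw [integral_finsetSum _ fun i _ => integrable_finsetSum _ fun j _ => hint i j]
  refine Finset.sum_congr rfl fun i _ => ?_
  rw [integral_finsetSum _ fun j _ => hint i j]
  refine Finset.sum_congr rfl fun j _ => ?_
  rw [integral_const_mul, integral_mul_sub_multivariateGaussian m a hV, mul_add]

theorem frobeniusInner_inv_self {V : Matrix ι ι ℝ} (hV : V.PosDef) :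
    frobeniusInner V⁻¹ V = Fintype.card ι := by
  have hsymm : Vᵀ = V := by simpa using hV.isHermitian.eq
  have htrace : frobeniusInner V⁻¹ V = (V⁻¹ * Vᵀ).trace := by
    simp [frobeniusInner, Matrix.trace, Matrix.mul_apply]
  rw [htrace, hsymm, Matrix.nonsing_inv_mul _ (isUnit_iff_ne_zero.2 hV.det_pos.ne'),
    Matrix.trace_one]

theorem toReal_klDiv_multivariateGaussian (m m₀ : EuclideanSpace ℝ ι) {V K : Matrix ι ι ℝ}
    (hV : V.PosDef) (hK : K.PosDef) :
    (InformationTheory.klDiv (multivariateGaussian m V) (multivariateGaussian m₀ K)).toReal =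
      1 / 2 * (frobeniusInner K⁻¹ V + (m - m₀).ofLp ⬝ᵥ (K⁻¹ *ᵥ (m - m₀).ofLp) -
        Fintype.card ι + Real.log K.det - Real.log V.det) := by
  have hμ := multivariateGaussian_eq_withDensity m hV
  have hν := multivariateGaussian_eq_withDensity m₀ hK
  have : IsProbabilityMeasure (volume.withDensity fun x =>
      ENNReal.ofReal (Real.exp (gaussianLogDensity m V x))) := hμ ▸ inferInstance
  have : IsProbabilityMeasure (volume.withDensity fun x =>
      ENNReal.ofReal (Real.exp (gaussianLogDensity m₀ K x))) := hν ▸ inferInstance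
  have hprior := (integrable_quadratic_multivariateGaussian m m₀ V K⁻¹).const_mul (1 / 2)
  have hself := (integrable_quadratic_multivariateGaussian m m V V⁻¹).const_mul (1 / 2)
  have hdiff : ∀ x, gaussianLogDensity m V x - gaussianLogDensity m₀ K x =
      1 / 2 * ((x - m₀).ofLp ⬝ᵥ (K⁻¹ *ᵥ (x - m₀).ofLp)) -
        1 / 2 * ((x - m).ofLp ⬝ᵥ (V⁻¹ *ᵥ (x - m).ofLp)) +
        1 / 2 * (Real.log K.det - Real.log V.det) := fun x => by
    unfold gaussianLogDensity
    ring
  rw [hμ, hν, toReal_klDiv_withDensity_exp (by fun_prop) (by fun_prop), ← hμ]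
  simp_rw [hdiff]
  rw [integral_add (by exact hprior.sub hself) (integrable_const _), integral_sub hprior hself,
    integral_const_mul, integral_const_mul, integral_const, probReal_univ, one_smul,
    integral_quadratic_multivariateGaussian m m hV.posSemidef,
    integral_quadratic_multivariateGaussian m m₀ hV.posSemidef, frobeniusInner_inv_self hV,
    sub_self, WithLp.ofLp_zero, zero_dotProduct]
  ring

/-- This is the nonnegativity of the divergence of `N(0, W)` from `N(0, V)`. -/
theorem log_det_sub_log_det_le {V W : Matrix ι ι ℝ} (hV : V.PosDef) (hW : W.PosDef) :
    Real.log W.det - Real.log V.det ≤ frobeniusInner V⁻¹ (W - V) := by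
  have hkl := toReal_klDiv_multivariateGaussian (0 : EuclideanSpace ℝ ι) 0 hW hV
  have hsub : frobeniusInner V⁻¹ (W - V) = frobeniusInner V⁻¹ W - Fintype.card ι := by
    rw [← frobeniusInner_inv_self hV]
    simp only [frobeniusInner, Matrix.sub_apply, mul_sub, Finset.sum_sub_distrib]
  rw [sub_self, WithLp.ofLp_zero, zero_dotProduct] at hkl
  linarith [hkl ▸ ENNReal.toReal_nonneg]

end GaussianDensity

section Loewner

open scoped Matrix.Norms.Frobenius

theorem posDef_of_sub_smul_one_posSemidef {ι : Type*} [DecidableEq ι] {lam : ℝ}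
    {V : Matrix ι ι ℝ} (hlam : 0 < lam) (hV : (V - lam • (1 : Matrix ι ι ℝ)).PosSemidef) :
    V.PosDef := by
  simpa using (Matrix.PosDef.one.smul hlam).posSemidef_add hV

variable {ι : Type*} [Fintype ι]

theorem frobeniusInner_sub_left (A B C : Matrix ι ι ℝ) :
    frobeniusInner (A - B) C = frobeniusInner A C - frobeniusInner B C := by
  simp [frobeniusInner, sub_mul]

theorem frobeniusInner_sub_right (A B C : Matrix ι ι ℝ) :
    frobeniusInner A (B - C) = frobeniusInner A B - frobeniusInner A C := by
  simp [frobeniusInner, mul_sub]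

theorem frobenius_norm_sq (A : Matrix ι ι ℝ) : ‖A‖ ^ 2 = ∑ i, ∑ j, A i j ^ 2 := by
  rw [Matrix.frobenius_norm_def, ← Real.sqrt_eq_rpow, Real.sq_sqrt (by positivity)]
  simp

theorem frobeniusInner_le_norm_mul_norm (A B : Matrix ι ι ℝ) :
    frobeniusInner A B ≤ ‖A‖ * ‖B‖ := by
  have h := Finset.sum_mul_sq_le_sq_mul_sq Finset.univ (fun ij : ι × ι => A ij.1 ij.2)
    (fun ij => B ij.1 ij.2)
  simp only [Fintype.sum_prod_type, ← frobenius_norm_sq, ← mul_pow] at h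
  exact le_of_sq_le_sq h (by positivity)

variable [DecidableEq ι] {lam : ℝ} {V W : Matrix ι ι ℝ}

theorem mul_dotProduct_self_le (hV : (V - lam • (1 : Matrix ι ι ℝ)).PosSemidef) (x : ι → ℝ) :
    lam * (x ⬝ᵥ x) ≤ x ⬝ᵥ (V *ᵥ x) := by
  have h := hV.dotProduct_mulVec_nonneg x
  simp only [star_trivial, Matrix.sub_mulVec, dotProduct_sub, Matrix.smul_mulVec,
    Matrix.one_mulVec, dotProduct_smul, smul_eq_mul] at h
  exact sub_nonneg.1 h

theorem sq_mul_dotProduct_self_le (hlam : 0 ≤ lam)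
    (hV : (V - lam • (1 : Matrix ι ι ℝ)).PosSemidef) (x : ι → ℝ) :
    lam ^ 2 * (x ⬝ᵥ x) ≤ (V *ᵥ x) ⬝ᵥ (V *ᵥ x) := by
  have hnonneg : 0 ≤ (lam • x - V *ᵥ x) ⬝ᵥ (lam • x - V *ᵥ x) :=
    Finset.sum_nonneg fun _ _ => mul_self_nonneg _
  simp only [sub_dotProduct, dotProduct_sub, smul_dotProduct, dotProduct_smul, smul_eq_mul,
    dotProduct_comm (V *ᵥ x) x] at hnonneg
  nlinarith [mul_le_mul_of_nonneg_left (mul_dotProduct_self_le hV x) hlam]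

theorem mul_frobenius_norm_le_norm_mul (hlam : 0 ≤ lam)
    (hV : (V - lam • (1 : Matrix ι ι ℝ)).PosSemidef) (A : Matrix ι ι ℝ) :
    lam * ‖A‖ ≤ ‖V * A‖ := by
  refine le_of_sq_le_sq ?_ (norm_nonneg _)
  rw [mul_pow, frobenius_norm_sq, frobenius_norm_sq, Finset.sum_comm, Finset.mul_sum,
    Finset.sum_comm (f := fun i j => (V * A) i j ^ 2)]
  refine Finset.sum_le_sum fun j _ => ?_
  simpa [dotProduct, Matrix.mulVec, Matrix.mul_apply, sq] using
    sq_mul_dotProduct_self_le hlam hV (A.col j)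

theorem norm_inv_sub_inv_le (hlam : 0 < lam) (hV : (V - lam • (1 : Matrix ι ι ℝ)).PosSemidef)
    (hW : (W - lam • (1 : Matrix ι ι ℝ)).PosSemidef) :
    ‖V⁻¹ - W⁻¹‖ ≤ (lam ^ 2)⁻¹ * ‖W - V‖ := by
  have hVpos := posDef_of_sub_smul_one_posSemidef hlam hV
  have hWpos := posDef_of_sub_smul_one_posSemidef hlam hW
  have hVunit := isUnit_iff_ne_zero.2 hVpos.det_pos.ne'
  have hWunit := isUnit_iff_ne_zero.2 hWpos.det_pos.ne'
  have hleft : V * (V⁻¹ - W⁻¹) = (W - V) * W⁻¹ := by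
    rw [mul_sub, sub_mul, Matrix.mul_nonsing_inv _ hVunit, Matrix.mul_nonsing_inv _ hWunit]
  have htranspose : W * ((W - V) * W⁻¹)ᵀ = W - V := by
    rw [Matrix.transpose_mul, Matrix.transpose_nonsing_inv, Matrix.transpose_sub,
      show Wᵀ = W from hWpos.isHermitian, show Vᵀ = V from hVpos.isHermitian,
      Matrix.mul_nonsing_inv_cancel_left _ _ hWunit]
  rw [inv_mul_eq_div, le_div_iff₀ (by positivity)]
  calc ‖V⁻¹ - W⁻¹‖ * lam ^ 2 = lam * (lam * ‖V⁻¹ - W⁻¹‖) := by ring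
    _ ≤ lam * ‖V * (V⁻¹ - W⁻¹)‖ := by
        gcongr
        exact mul_frobenius_norm_le_norm_mul hlam.le hV _
    _ = lam * ‖((W - V) * W⁻¹)ᵀ‖ := by rw [hleft, Matrix.frobenius_norm_transpose]
    _ ≤ ‖W * ((W - V) * W⁻¹)ᵀ‖ := mul_frobenius_norm_le_norm_mul hlam.le hW _
    _ = ‖W - V‖ := by rw [htranspose]

theorem abs_log_det_sub_log_det_sub_le (hlam : 0 < lam)
    (hV : (V - lam • (1 : Matrix ι ι ℝ)).PosSemidef)
    (hW : (W - lam • (1 : Matrix ι ι ℝ)).PosSemidef) :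
    |Real.log W.det - Real.log V.det - frobeniusInner V⁻¹ (W - V)| ≤
      (lam ^ 2)⁻¹ * ‖W - V‖ ^ 2 := by
  have hVpos := posDef_of_sub_smul_one_posSemidef hlam hV
  have hWpos := posDef_of_sub_smul_one_posSemidef hlam hW
  have hupper := log_det_sub_log_det_le hVpos hWpos
  have hlower := log_det_sub_log_det_le hWpos hVpos
  have hinv : frobeniusInner (V⁻¹ - W⁻¹) (W - V) ≤ (lam ^ 2)⁻¹ * ‖W - V‖ ^ 2 :=
    calc frobeniusInner (V⁻¹ - W⁻¹) (W - V) ≤ ‖V⁻¹ - W⁻¹‖ * ‖W - V‖ :=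
          frobeniusInner_le_norm_mul_norm _ _
      _ ≤ (lam ^ 2)⁻¹ * ‖W - V‖ * ‖W - V‖ := by
          gcongr
          exact norm_inv_sub_inv_le hlam hV hW
      _ = (lam ^ 2)⁻¹ * ‖W - V‖ ^ 2 := by ring
  simp only [frobeniusInner_sub_left, frobeniusInner_sub_right] at hupper hlower hinv ⊢
  rw [abs_le]
  constructor <;> linarith

end Loewner

section KLGradient

theorem norm_le_norm_fst_add_norm_snd {E F : Type*} [NormedAddCommGroup E] [NormedAddCommGroup F]
    (x : WithLp 2 (E × F)) : ‖x‖ ≤ ‖x.fst‖ + ‖x.snd‖ := by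
  refine le_of_sq_le_sq ?_ (by positivity)
  rw [WithLp.prod_norm_sq_eq_of_L2]
  nlinarith [mul_nonneg (norm_nonneg x.fst) (norm_nonneg x.snd)]

open scoped Matrix.Norms.Frobenius

variable {k : ℕ}

/-- The matrix of a vectorized symmetric matrix. -/
def matrixOf : SymMat k →ₗ[ℝ] Matrix (Fin k) (Fin k) ℝ where
  toFun H := Matrix.of fun i j => (H : EuclideanSpace ℝ (Fin k × Fin k)) (i, j)
  map_add' _ _ := rfl
  map_smul' _ _ := rfl

/-- The vectorized symmetric part of a matrix, which represents the functional
`H ↦ ⟪A, H⟫` on symmetric matrices. -/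
def symPart : Matrix (Fin k) (Fin k) ℝ →ₗ[ℝ] SymMat k where
  toFun A := ⟨WithLp.toLp 2 fun ij => (A ij.1 ij.2 + A ij.2 ij.1) / 2, fun i j => by
    simp [add_comm]⟩
  map_add' A B := by
    ext ij
    simp
    ring
  map_smul' c A := by
    ext ij
    simp
    ring

theorem transpose_matrixOf (H : SymMat k) : (matrixOf H)ᵀ = matrixOf H := by
  ext i j
  exact H.2 j i

theorem norm_matrixOf (H : SymMat k) : ‖matrixOf H‖ = ‖H‖ := by
  rw [← sq_eq_sq₀ (norm_nonneg _) (norm_nonneg _), frobenius_norm_sq, ← Submodule.norm_coe,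
    EuclideanSpace.real_norm_sq_eq, Fintype.sum_prod_type]
  rfl

theorem matrixOf_symPart (A : Matrix (Fin k) (Fin k) ℝ) :
    matrixOf (symPart A) = (1 / 2 : ℝ) • (A + Aᵀ) := by
  ext i j
  change (A i j + A j i) / 2 = 1 / 2 * (A i j + A j i)
  ring

theorem norm_symPart_le (A : Matrix (Fin k) (Fin k) ℝ) : ‖symPart A‖ ≤ ‖A‖ := by
  rw [← norm_matrixOf, matrixOf_symPart, norm_smul]
  have h := norm_add_le A Aᵀ
  rw [Matrix.frobenius_norm_transpose] at h
  norm_num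
  linarith

theorem inner_symPart (A : Matrix (Fin k) (Fin k) ℝ) (H : SymMat k) :
    inner ℝ (symPart A) H = frobeniusInner A (matrixOf H) := by
  have htranspose : frobeniusInner Aᵀ (matrixOf H) = frobeniusInner A (matrixOf H) := by
    conv_lhs => rw [← transpose_matrixOf H]
    exact Finset.sum_comm
  have hinner : inner ℝ (symPart A) H =
      (frobeniusInner A (matrixOf H) + frobeniusInner Aᵀ (matrixOf H)) / 2 := by
    rw [Submodule.coe_inner, PiLp.inner_apply, Fintype.sum_prod_type]
    simp only [frobeniusInner, ← Finset.sum_add_distrib, Finset.sum_div]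
    refine Finset.sum_congr rfl fun i _ => Finset.sum_congr rfl fun j _ => ?_
    change H.1 (i, j) * ((A i j + A j i) / 2) = (A i j * H.1 (i, j) + A j i * H.1 (i, j)) / 2
    ring
  rw [hinner, htranspose, add_self_div_two]

theorem Param.V_sub (r r' : Param k) : r'.V - r.V = matrixOf (r' - r).snd := by
  simp only [WithLp.sub_snd, map_sub]
  rfl

theorem Param.norm_V_sub_le (r r' : Param k) : ‖r'.V - r.V‖ ≤ ‖r' - r‖ := by
  rw [r.V_sub, norm_matrixOf]
  exact WithLp.norm_snd_le _ _

namespace Model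

variable {Y : Type*} {n : ℕ} (D : Model Y n k)

/-- The gradient of `kl` at the parameters with a positive definite covariance. -/
def klGradient (r : Param k) : Param k :=
  WithLp.toLp 2 (Matrix.toEuclideanCLM (𝕜 := ℝ) D.K₀⁻¹ (r.m - D.m₀),
    (1 / 2 : ℝ) • symPart (D.K₀⁻¹ - r.V⁻¹))

theorem kl_sub_kl_sub_inner_klGradient (hK : D.K₀.PosDef) {r r' : Param k} (hr : r.V.PosDef)
    (hr' : r'.V.PosDef) :
    D.kl r' - D.kl r - inner ℝ (D.klGradient r) (r' - r) =
      1 / 2 * inner ℝ (Matrix.toEuclideanCLM (𝕜 := ℝ) D.K₀⁻¹ (r' - r).fst) (r' - r).fst -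
        1 / 2 * (Real.log r'.V.det - Real.log r.V.det - frobeniusInner r.V⁻¹ (r'.V - r.V)) := by
  set T := Matrix.toEuclideanCLM (𝕜 := ℝ) D.K₀⁻¹ with hT
  have hself : ∀ x y, inner ℝ (T x) y = inner ℝ x (T y) := fun x y => by
    have hT : IsSelfAdjoint T :=
      IsSelfAdjoint.map (f := Matrix.toEuclideanCLM (𝕜 := ℝ)) hK.isHermitian.inv
    rw [← ContinuousLinearMap.adjoint_inner_right, hT.adjoint_eq]
  have hkl : ∀ r : Param k, r.V.PosDef → D.kl r = 1 / 2 * (frobeniusInner D.K₀⁻¹ r.V +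
      inner ℝ (r.m - D.m₀) (T (r.m - D.m₀)) - Fintype.card (Fin k) +
        Real.log D.K₀.det - Real.log r.V.det) := fun r hr => by
    rw [hT, Matrix.inner_toEuclideanCLM]
    exact toReal_klDiv_multivariateGaussian _ _ hr hK
  have hinner : inner ℝ (D.klGradient r) (r' - r) = inner ℝ (T (r.m - D.m₀)) (r' - r).fst +
      1 / 2 * frobeniusInner (D.K₀⁻¹ - r.V⁻¹) (r'.V - r.V) := by
    rw [WithLp.prod_inner_apply, r.V_sub, ← inner_symPart]
    congr 1
    exact real_inner_smul_left (symPart _) (r' - r).snd _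
  have hm : r'.m - D.m₀ = (r.m - D.m₀) + (r' - r).fst := by simp [Param.m]
  rw [hkl r hr, hkl r' hr', hinner, hm, map_add, inner_add_left, inner_add_right, inner_add_right,
    ← hself, ← hself, real_inner_comm (T (r.m - D.m₀)) (r' - r).fst, hself (r' - r).fst,
    frobeniusInner_sub_left, frobeniusInner_sub_right D.K₀⁻¹]
  ring

variable {lam : ℝ≥0}

theorem lipschitzOnWith_klGradient (hlam : 0 < lam) :
    LipschitzOnWith (‖Matrix.toEuclideanCLM (𝕜 := ℝ) D.K₀⁻¹‖₊ + (lam ^ 2)⁻¹) D.klGradient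
      {r | (r.V - (lam : ℝ) • (1 : Matrix (Fin k) (Fin k) ℝ)).PosSemidef} := by
  refine LipschitzOnWith.of_dist_le_mul fun r hr r' hr' => ?_
  have hinv := norm_inv_sub_inv_le hlam hr' hr
  set T := Matrix.toEuclideanCLM (𝕜 := ℝ) D.K₀⁻¹
  have hfst : (D.klGradient r - D.klGradient r').fst = T (r - r').fst := by
    simp [klGradient, Param.m, ← map_sub, T]
  have hsnd : (D.klGradient r - D.klGradient r').snd =
      (1 / 2 : ℝ) • symPart (r'.V⁻¹ - r.V⁻¹) := by
    change (1 / 2 : ℝ) • symPart (D.K₀⁻¹ - r.V⁻¹) - (1 / 2 : ℝ) • symPart (D.K₀⁻¹ - r'.V⁻¹) = _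
    rw [← smul_sub, ← map_sub, sub_sub_sub_cancel_left]
  rw [dist_eq_norm, dist_eq_norm]
  calc ‖D.klGradient r - D.klGradient r'‖
      ≤ ‖T (r - r').fst‖ + ‖(1 / 2 : ℝ) • symPart (r'.V⁻¹ - r.V⁻¹)‖ := by
        rw [← hfst, ← hsnd]
        exact norm_le_norm_fst_add_norm_snd _
    _ ≤ ‖T‖ * ‖r - r'‖ + ((lam : ℝ) ^ 2)⁻¹ * ‖r - r'‖ := by
        gcongr
        · exact T.le_opNorm_of_le (WithLp.norm_fst_le _ _)
        · calc ‖(1 / 2 : ℝ) • symPart (r'.V⁻¹ - r.V⁻¹)‖ ≤ 1 * ‖r'.V⁻¹ - r.V⁻¹‖ := by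
                rw [norm_smul]
                gcongr
                · norm_num
                · exact norm_symPart_le _
            _ ≤ ((lam : ℝ) ^ 2)⁻¹ * ‖r - r'‖ := by
                rw [one_mul]
                exact hinv.trans
                  (mul_le_mul_of_nonneg_left (Param.norm_V_sub_le r' r) (by positivity))
    _ = _ := by
        push_cast
        ring

theorem hasLipschitzGradientOn_kl (hK : D.K₀.PosDef) (hlam : 0 < lam) :
    HasLipschitzGradientOn (‖Matrix.toEuclideanCLM (𝕜 := ℝ) D.K₀⁻¹‖₊ + (lam ^ 2)⁻¹)
      D.kl D.klGradient {r | (r.V - (lam : ℝ) • (1 : Matrix (Fin k) (Fin k) ℝ)).PosSemidef} := by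
  refine ⟨fun r hr r' hr' => ?_, D.lipschitzOnWith_klGradient hlam⟩
  have hlam' : (0 : ℝ) < lam := hlam
  set T := Matrix.toEuclideanCLM (𝕜 := ℝ) D.K₀⁻¹
  have hquad : |inner ℝ (T (r' - r).fst) (r' - r).fst| ≤ ‖T‖ * ‖r' - r‖ ^ 2 :=
    calc |inner ℝ (T (r' - r).fst) (r' - r).fst| ≤ ‖T (r' - r).fst‖ * ‖(r' - r).fst‖ :=
          abs_real_inner_le_norm _ _
      _ ≤ ‖T‖ * ‖r' - r‖ * ‖r' - r‖ := by
          gcongr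
          · exact T.le_opNorm_of_le (WithLp.norm_fst_le _ _)
          · exact WithLp.norm_fst_le _ _
      _ = ‖T‖ * ‖r' - r‖ ^ 2 := by ring
  have hdet := abs_log_det_sub_log_det_sub_le hlam' hr hr'
  have hV := Param.norm_V_sub_le r r'
  rw [D.kl_sub_kl_sub_inner_klGradient hK (posDef_of_sub_smul_one_posSemidef hlam' hr)
    (posDef_of_sub_smul_one_posSemidef hlam' hr')]
  have hdet' := hdet.trans (mul_le_mul_of_nonneg_left (pow_le_pow_left₀ (norm_nonneg _) hV 2)
    (by positivity : 0 ≤ ((lam : ℝ) ^ 2)⁻¹))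
  push_cast
  rw [abs_le] at hquad hdet' ⊢
  constructor <;> linarith

end Model

end KLGradient

section Parameters

variable {k : ℕ}

theorem norm_outer (a : EuclideanSpace ℝ (Fin k)) : ‖outer a‖ = ‖a‖ ^ 2 := by
  rw [← sq_eq_sq₀ (norm_nonneg _) (sq_nonneg _), ← Submodule.norm_coe,
    EuclideanSpace.real_norm_sq_eq, EuclideanSpace.real_norm_sq_eq, Fintype.sum_prod_type,
    sq (∑ i, a i ^ 2), Finset.sum_mul_sum]
  exact Finset.sum_congr rfl fun i _ => Finset.sum_congr rfl fun j _ => mul_pow _ _ _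

theorem inner_outer (a : EuclideanSpace ℝ (Fin k)) (H : SymMat k) :
    inner ℝ (outer a) H = a.ofLp ⬝ᵥ (matrixOf H *ᵥ a.ofLp) := by
  rw [dotProduct_mulVec_eq_sum, Submodule.coe_inner, PiLp.inner_apply, Fintype.sum_prod_type]
  rfl

theorem Param.dotProduct_mulVec_V_sub (a : EuclideanSpace ℝ (Fin k)) (r r' : Param k) :
    a.ofLp ⬝ᵥ (r'.V *ᵥ a.ofLp) - a.ofLp ⬝ᵥ (r.V *ᵥ a.ofLp) =
      inner ℝ (outer a) (r' - r).snd := by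
  rw [inner_outer, ← r.V_sub, Matrix.sub_mulVec, dotProduct_sub]

theorem Param.posSemidef_V_sub_of_norm_sub_le {r r' : Param k} {lam lam' : ℝ}
    (hr : (r.V - lam • (1 : Matrix (Fin k) (Fin k) ℝ)).PosSemidef)
    (hle : lam' + ‖r' - r‖ ≤ lam) :
    (r'.V - lam' • (1 : Matrix (Fin k) (Fin k) ℝ)).PosSemidef := by
  refine Matrix.PosSemidef.of_dotProduct_mulVec_nonneg ?_ fun x => ?_
  · have hV : (r'.V)ᵀ = r'.V := transpose_matrixOf r'.snd
    rw [Matrix.IsHermitian, Matrix.conjTranspose_eq_transpose_of_trivial, Matrix.transpose_sub,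
      hV, Matrix.transpose_smul, Matrix.transpose_one]
  · set X : EuclideanSpace ℝ (Fin k) := WithLp.toLp 2 x
    have hX : x ⬝ᵥ x = ‖X‖ ^ 2 := by
      rw [EuclideanSpace.real_norm_sq_eq]
      exact Finset.sum_congr rfl fun i _ => (sq _).symm
    have hform := Param.dotProduct_mulVec_V_sub X r r'
    have hinner : |inner ℝ (outer X) (r' - r).snd| ≤ ‖X‖ ^ 2 * ‖r' - r‖ := by
      refine (abs_real_inner_le_norm _ _).trans ?_
      rw [norm_outer]
      exact mul_le_mul_of_nonneg_left (WithLp.norm_snd_le _ _) (sq_nonneg _)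
    have hlow := mul_dotProduct_self_le hr x
    simp only [star_trivial, Matrix.sub_mulVec, dotProduct_sub, Matrix.smul_mulVec,
      Matrix.one_mulVec, dotProduct_smul, smul_eq_mul]
    rw [hX] at hlow ⊢
    nlinarith [neg_abs_le (inner ℝ (outer X) (r' - r).snd), sq_nonneg ‖X‖]

theorem Param.setOf_posSemidef_V_sub_mem_nhds {r : Param k} {lam lam' : ℝ}
    (hr : (r.V - lam • (1 : Matrix (Fin k) (Fin k) ℝ)).PosSemidef) (hlam : lam' < lam) :
    {r' : Param k | (r'.V - lam' • (1 : Matrix (Fin k) (Fin k) ℝ)).PosSemidef} ∈ 𝓝 r := by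
  filter_upwards [Metric.ball_mem_nhds r (sub_pos.2 hlam)] with r' hr'
  rw [mem_ball_iff_norm] at hr'
  exact posSemidef_V_sub_of_norm_sub_le hr (by linarith)

end Parameters

namespace Model

variable {Y : Type*} {n k : ℕ} (D : Model Y n k)

/-- The gradient of the affine function `mean i`. -/
def meanGradient (i : Fin n) : Param k := WithLp.toLp 2 (D.a₁ i, 0)

/-- The gradient of the affine function `var i`. -/
def varGradient (i : Fin n) : Param k := WithLp.toLp 2 (0, outer (D.a₂ i))

theorem mean_sub (i : Fin n) (r r' : Param k) :
    D.mean i r' - D.mean i r = inner ℝ (D.meanGradient i) (r' - r) := by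
  have hinner : inner ℝ (D.meanGradient i) (r' - r) = inner ℝ (D.a₁ i) (r'.m - r.m) := by
    rw [WithLp.prod_inner_apply]
    exact (congrArg _ (inner_zero_left _)).trans (add_zero _)
  rw [hinner, inner_sub_right, EuclideanSpace.inner_eq_star_dotProduct,
    EuclideanSpace.inner_eq_star_dotProduct, star_trivial, dotProduct_comm _ (D.a₁ i).ofLp,
    dotProduct_comm _ (D.a₁ i).ofLp, mean, mean]
  ring

theorem var_sub (i : Fin n) (r r' : Param k) :
    D.var i r' - D.var i r = inner ℝ (D.varGradient i) (r' - r) := by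
  have hinner : inner ℝ (D.varGradient i) (r' - r) = inner ℝ (outer (D.a₂ i)) (r' - r).snd := by
    rw [WithLp.prod_inner_apply]
    exact (congrArg (· + _) (inner_zero_left _)).trans (zero_add _)
  rw [hinner, ← Param.dotProduct_mulVec_V_sub, var, var]
  ring

theorem continuous_var (i : Fin n) : Continuous (D.var i) :=
  (lipschitzWith_of_sub_eq_inner (D.var_sub i)).continuous

/-- The direction with coefficients `x` and `y` along the gradients of the mean and of half the
variance of `q(f_i | r)`. By Stein's identity, the gradients of the predictive expectations and
their Monte Carlo estimates are of this form. -/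
def direction (i : Fin n) (x y : ℝ) : Param k :=
  x • D.meanGradient i + y • (1 / 2 : ℝ) • D.varGradient i

theorem direction_sub (i : Fin n) (x y x' y' : ℝ) :
    D.direction i x y - D.direction i x' y' = D.direction i (x - x') (y - y') := by
  unfold direction
  module

theorem smul_direction (i : Fin n) (c x y : ℝ) :
    c • D.direction i x y = D.direction i (c * x) (c * y) := by
  unfold direction
  module

theorem norm_direction_le (i : Fin n) (x y : ℝ) :
    ‖D.direction i x y‖ ≤ |x| * ‖D.meanGradient i‖ + |y| * ‖D.varGradient i‖ := by
  refine (norm_add_le _ _).trans ?_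
  rw [norm_smul, norm_smul, norm_smul, Real.norm_eq_abs, Real.norm_eq_abs]
  gcongr
  refine mul_le_of_le_one_left (norm_nonneg _) ?_
  norm_num

/-- The gradient of the predictive expectation of example `i`. -/
def predictiveGradient (i : Fin n) (r : Param k) : Param k :=
  D.direction i (smooth (deriv (D.p (D.y i))) (D.mean i r) (D.var i r))
    (smooth (deriv (deriv (D.p (D.y i)))) (D.mean i r) (D.var i r))

/-- The gradient of the objective on its domain. -/
def objectiveGradient (r : Param k) : Param k :=
  -(1 / (n : ℝ)) • (∑ i, (D.predictive i r)⁻¹ • D.predictiveGradient i r) +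
    (D.β / n) • D.klGradient r

variable {D} {M ζ lam : ℝ≥0}

theorem DerivativeBounds.exists_boundedDerivs {B b' B' b'' B'' : ℝ}
    (h : D.DerivativeBounds B b' B' b'' B'') : ∃ M, ∀ i, BoundedDerivs M (D.p (D.y i)) := by
  refine ⟨(max B (max (max |b'| |B'|) (max |b''| |B''|))).toNNReal, fun i =>
    ⟨h.differentiable i, h.differentiable_deriv i, fun x => ?_, fun x => ?_, fun x => ?_⟩⟩
  · refine le_trans ?_ (Real.le_coe_toNNReal _)
    rw [abs_of_nonneg (h.bound i x).1]
    exact le_max_of_le_left (h.bound i x).2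
  · refine le_trans ?_ (Real.le_coe_toNNReal _)
    exact le_max_of_le_right (le_max_of_le_left
      (abs_le_max_abs_abs (h.bound' i x).1 (h.bound' i x).2))
  · refine le_trans ?_ (Real.le_coe_toNNReal _)
    exact le_max_of_le_right (le_max_of_le_right
      (abs_le_max_abs_abs (h.bound'' i x).1 (h.bound'' i x).2))

theorem predictive_eq_smooth {i : Fin n} (hD : Measurable (D.p (D.y i))) {r : Param k}
    (hr : 0 ≤ D.var i r) :
    D.predictive i r = smooth (D.p (D.y i)) (D.mean i r) (D.var i r) :=
  integral_gaussianReal_eq_smooth hD _ hr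

section Predictive

variable {i : Fin n} (hD : BoundedDerivs M (D.p (D.y i)))

include hD

theorem norm_predictiveGradient_le (r : Param k) :
    ‖D.predictiveGradient i r‖ ≤ M * ‖D.meanGradient i‖ + M * ‖D.varGradient i‖ := by
  refine (D.norm_direction_le i _ _).trans ?_
  gcongr
  · exact abs_smooth_le hD.abs_deriv_le _ _
  · exact abs_smooth_le hD.abs_deriv_deriv_le _ _

theorem eqOn_predictive_smooth : Set.EqOn (D.predictive i)
    (fun r => smooth (D.p (D.y i)) (D.mean i r) (D.var i r)) {r | lam ≤ D.var i r} :=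
  fun _ hr => predictive_eq_smooth hD.differentiable.continuous.measurable (lam.2.trans hr)

theorem exists_lipschitzOnWith_predictive (hlam : 0 < lam) :
    ∃ C, LipschitzOnWith C (D.predictive i) {r | lam ≤ D.var i r} := by
  obtain ⟨C, hC⟩ := exists_lipschitzOnWith_smooth hD (D.mean_sub i) (D.var_sub i) hlam
  refine ⟨C, fun r hr r' hr' => ?_⟩
  rw [eqOn_predictive_smooth hD hr, eqOn_predictive_smooth hD hr']
  exact hC hr hr'

theorem exists_hasLipschitzGradientOn_predictive (hlam : 0 < lam) :
    ∃ C, HasLipschitzGradientOn C (D.predictive i) (D.predictiveGradient i)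
      {r | lam ≤ D.var i r} := by
  obtain ⟨C, hC⟩ := exists_hasLipschitzGradientOn_smooth hD (D.mean_sub i) (D.var_sub i) hlam
  exact ⟨C, hC.congr (eqOn_predictive_smooth hD)⟩

theorem exists_hasLipschitzGradientOn_log_predictive (hζ : 0 < ζ) (hlam : 0 < lam) :
    ∃ C, HasLipschitzGradientOn C (fun r => Real.log (D.predictive i r))
      (fun r => (D.predictive i r)⁻¹ • D.predictiveGradient i r)
      {r | ζ ≤ D.predictive i r ∧ lam ≤ D.var i r} := by
  obtain ⟨K, hK⟩ := exists_lipschitzOnWith_predictive hD hlam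
  obtain ⟨C, hC⟩ := exists_hasLipschitzGradientOn_predictive hD hlam
  refine ⟨_, (hasLipschitzGradientOn_log hζ).comp (N := ζ⁻¹)
    (M := M * ‖D.meanGradient i‖₊ + M * ‖D.varGradient i‖₊) (hC.mono fun r hr => hr.2)
    (fun r hr => hr.1) (hK.mono fun r hr => hr.2) (fun t ht => ?_)
    fun r _ => norm_predictiveGradient_le hD r⟩
  have hζ' : (0 : ℝ) < ζ := hζ
  have ht' : (ζ : ℝ) ≤ t := ht
  rw [abs_of_pos (inv_pos.2 (hζ'.trans_le ht')), NNReal.coe_inv]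
  exact inv_anti₀ hζ' ht'

theorem continuousAt_predictive {r : Param k} (hr : 0 < D.var i r) :
    ContinuousAt (D.predictive i) r := by
  obtain ⟨lam, hlam, hlt⟩ := exists_between hr
  lift lam to ℝ≥0 using hlam.le
  obtain ⟨C, hC⟩ := exists_hasLipschitzGradientOn_predictive hD (NNReal.coe_pos.1 hlam)
  exact (hC.hasGradientAt ((D.continuous_var i).continuousAt.eventually
    (le_mem_nhds hlt))).differentiableAt.continuousAt

end Predictive

section Objective

theorem gradient_kl (hK : D.K₀.PosDef) (hlam : 0 < lam) {r : Param k}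
    (hr : (r.V - (lam : ℝ) • (1 : Matrix (Fin k) (Fin k) ℝ)).PosSemidef) :
    ∇ D.kl r = D.klGradient r :=
  ((D.hasLipschitzGradientOn_kl hK (half_pos hlam)).hasGradientAt
    (Param.setOf_posSemidef_V_sub_mem_nhds hr (NNReal.half_lt_self hlam.ne'))).gradient

theorem bmcDirection_add_objectiveGradient (hβ : 0 ≤ D.β) (hK : D.K₀.PosDef) (hlam : 0 < lam)
    {r : Param k} (hr : r ∈ D.domain ζ lam) (L : ℕ) (ε : Fin n → ℕ → ℝ) :
    D.bmcDirection L ε r + D.objectiveGradient r = (1 / (n : ℝ)) •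
      ∑ i, (D.exampleDirection i L (ε i) r - (D.predictive i r)⁻¹ • D.predictiveGradient i r) := by
  have hkl : (D.β / n) • ∇ D.kl r = (D.β / n) • D.klGradient r := by
    rcases hβ.eq_or_lt with h0 | h0
    · simp [← h0]
    · rw [gradient_kl hK hlam (hr.2.2 h0)]
  rw [bmcDirection, objectiveGradient, hkl, Finset.sum_sub_distrib, smul_sub, neg_smul]
  abel

variable (hD : ∀ i, BoundedDerivs M (D.p (D.y i)))

include hD

theorem domain_mem_nhds (hlam₀ : 0 < lam) {ζ' lam' : ℝ} (hζ : ζ' < ζ) (hlam : lam' < lam)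
    {r : Param k} (hr : r ∈ D.domain ζ lam) : D.domain ζ' lam' ∈ 𝓝 r := by
  have hvar : ∀ᶠ r' in 𝓝 r, ∀ i, lam' ≤ D.var i r' := eventually_all.2 fun i =>
    (D.continuous_var i).continuousAt.eventually (le_mem_nhds (hlam.trans_le (hr.2.1 i)))
  have hpredictive : ∀ᶠ r' in 𝓝 r, ∀ i, ζ' ≤ D.predictive i r' := eventually_all.2 fun i =>
    (continuousAt_predictive (hD i) ((NNReal.coe_pos.2 hlam₀).trans_le (hr.2.1 i))).eventually
      (le_mem_nhds (hζ.trans_le (hr.1 i)))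
  have hV : ∀ᶠ r' in 𝓝 r, 0 < D.β →
      (Param.V r' - lam' • (1 : Matrix (Fin k) (Fin k) ℝ)).PosSemidef := by
    by_cases h0 : 0 < D.β
    · filter_upwards [Param.setOf_posSemidef_V_sub_mem_nhds (hr.2.2 h0) hlam] with r' h _ using h
    · exact Eventually.of_forall fun _ h => absurd h h0
  filter_upwards [hpredictive, hvar, hV] with r' h₁ h₂ h₃ using ⟨h₁, h₂, h₃⟩

theorem neg_log_le_objective (hβ : 0 ≤ D.β) (hζ : 0 < ζ) {r : Param k}
    (hr : r ∈ D.domain ζ lam) :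
    -(1 / (n : ℝ)) * (n * Real.log M) ≤ D.objective r := by
  have hlog : ∑ i, Real.log (D.predictive i r) ≤ n * Real.log M := by
    have hle : ∀ i ∈ Finset.univ, Real.log (D.predictive i r) ≤ Real.log M := fun i _ => by
      refine Real.log_le_log ((NNReal.coe_pos.2 hζ).trans_le (hr.1 i)) ?_
      rw [eqOn_predictive_smooth (hD i) (hr.2.1 i)]
      exact (le_abs_self _).trans (abs_smooth_le (hD i).abs_le _ _)
    simpa using Finset.sum_le_card_nsmul _ _ _ hle
  have hkl : 0 ≤ D.β / n * D.kl r := mul_nonneg (by positivity) ENNReal.toReal_nonneg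
  have hscaled := mul_le_mul_of_nonneg_left hlog (by positivity : 0 ≤ 1 / (n : ℝ))
  unfold objective
  linarith

variable (hβ : 0 ≤ D.β) (hK : D.K₀.PosDef) (hζ : 0 < ζ) (hlam : 0 < lam)

include hβ hK hζ hlam

theorem exists_hasLipschitzGradientOn_objective :
    ∃ C, HasLipschitzGradientOn C D.objective D.objectiveGradient (D.domain ζ lam) := by
  choose C hC using fun i => exists_hasLipschitzGradientOn_log_predictive (hD i) hζ hlam
  have hloss := (HasLipschitzGradientOn.sum Finset.univ fun i _ => (hC i).mono
    fun r (hr : r ∈ D.domain ζ lam) => ⟨hr.1 i, hr.2.1 i⟩).const_mul (-(1 / (n : ℝ)))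
  obtain ⟨C', hkl⟩ : ∃ C', HasLipschitzGradientOn C' (fun r => D.β / n * D.kl r)
      (fun r => (D.β / n) • D.klGradient r) (D.domain ζ lam) := by
    rcases hβ.eq_or_lt with h0 | h0
    · exact ⟨0, by simpa [← h0] using HasLipschitzGradientOn.zero⟩
    · exact ⟨_, ((D.hasLipschitzGradientOn_kl hK hlam).mono fun r hr => hr.2.2 h0).const_mul _⟩
  exact ⟨_, hloss.add hkl⟩

theorem hasGradientAt_objective {r : Param k} (hr : r ∈ D.domain ζ lam) :
    HasGradientAt D.objective (D.objectiveGradient r) r := by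
  obtain ⟨C, hC⟩ :=
    exists_hasLipschitzGradientOn_objective hD hβ hK (half_pos hζ) (half_pos hlam)
  exact hC.hasGradientAt (domain_mem_nhds hD hlam (NNReal.half_lt_self hζ.ne')
    (NNReal.half_lt_self hlam.ne') hr)

end Objective

end Model

section Concentration

variable {Ω : Type*} {m mΩ : MeasurableSpace Ω} {P : Measure Ω} [IsProbabilityMeasure P]

theorem exp_neg_sq_div_le {w η κ N : ℝ} (hw : 0 < w) (hκ : 0 < κ) (hN : 0 < N)
    (h : Real.log (2 / κ) * w ^ 2 ≤ 2 * N * η ^ 2) :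
    Real.exp (-(N * η) ^ 2 / (2 * N * (w / 2) ^ 2)) ≤ κ / 2 := by
  have hexponent : -(N * η) ^ 2 / (2 * N * (w / 2) ^ 2) = -(2 * N * η ^ 2 / w ^ 2) := by
    field_simp
  rw [← Real.le_log_iff_exp_le (half_pos hκ), hexponent, ← inv_div 2 κ, Real.log_inv,
    neg_le_neg_iff]
  exact (le_div_iff₀ (by positivity)).2 h

theorem measureReal_le_sum_sub_le {X : ℕ → Ω → ℝ} {a b c η κ : ℝ} {N : ℕ}
    (hX : ∀ l, Measurable (X l)) (hind : iIndepFun X P) (hab : ∀ l ω, X l ω ∈ Set.Icc a b)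
    (hc : ∀ l, P[X l] = c) (hη : 0 ≤ η) (hκ : 0 < κ) (hlt : a < b) (hN : 0 < N)
    (h : Real.log (2 / κ) * (b - a) ^ 2 ≤ 2 * N * η ^ 2) :
    P.real {ω | N * η ≤ ∑ l ∈ Finset.range N, (X l ω - c)} ≤ κ / 2 := by
  have hsubgaussian : ∀ l, HasSubgaussianMGF (fun ω => X l ω - c) ((‖b - a‖₊ / 2) ^ 2) P :=
    fun l => hc l ▸ hasSubgaussianMGF_of_mem_Icc (hX l).aemeasurable (ae_of_all P (hab l))
  have hparameter : (((‖b - a‖₊ / 2) ^ 2 : ℝ≥0) : ℝ) = ((b - a) / 2) ^ 2 := by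
    simp [div_pow]
  refine (HasSubgaussianMGF.measure_sum_range_ge_le_of_iIndepFun
    (hind.comp (fun _ x => x - c) fun _ => by fun_prop) (fun l _ => hsubgaussian l)
    (by positivity)).trans ?_
  rw [hparameter]
  exact exp_neg_sq_div_le (sub_pos.2 hlt) hκ (Nat.cast_pos.2 hN) h

theorem measureReal_abs_sum_sub_gt_le {X : ℕ → Ω → ℝ} {a b c η κ : ℝ} {N : ℕ}
    (hX : ∀ l, Measurable (X l)) (hind : iIndepFun X P) (hab : ∀ l ω, X l ω ∈ Set.Icc a b)
    (hc : ∀ l, P[X l] = c) (hη : 0 ≤ η) (hκ : 0 < κ)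
    (h : Real.log (2 / κ) * (b - a) ^ 2 ≤ 2 * N * η ^ 2) :
    P.real {ω | N * η < |∑ l ∈ Finset.range N, (X l ω - c)|} ≤ κ := by
  obtain ⟨ω₀⟩ := P.nonempty_of_neZero
  rcases ((hab 0 ω₀).1.trans (hab 0 ω₀).2).eq_or_lt with rfl | hlt
  · have hXa : ∀ l ω, X l ω = a := fun l ω => le_antisymm (hab l ω).2 (hab l ω).1
    have hca : c = a := by simpa [hXa] using (hc 0).symm
    have hempty : {ω | N * η < |∑ l ∈ Finset.range N, (X l ω - c)|} = ∅ := by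
      simp [hXa, hca, Set.eq_empty_iff_forall_notMem, mul_nonneg N.cast_nonneg hη]
    rw [hempty, measureReal_empty]
    exact hκ.le
  rcases N.eq_zero_or_pos with rfl | hN
  · simpa using hκ.le
  have hupper := measureReal_le_sum_sub_le hX hind hab hc hη hκ hlt hN h
  have hlower := measureReal_le_sum_sub_le (X := fun l ω => -X l ω) (a := -b) (b := -a) (c := -c)
    (fun l => (hX l).neg) (hind.comp (fun _ x => -x) fun _ => by fun_prop)
    (fun l ω => ⟨neg_le_neg (hab l ω).2, neg_le_neg (hab l ω).1⟩)
    (fun l => by rw [integral_neg, hc]) hη hκ (neg_lt_neg hlt) hN (by rwa [neg_sub_neg])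
  calc P.real {ω | N * η < |∑ l ∈ Finset.range N, (X l ω - c)|}
      ≤ P.real ({ω | N * η ≤ ∑ l ∈ Finset.range N, (X l ω - c)} ∪
          {ω | N * η ≤ ∑ l ∈ Finset.range N, (-X l ω - -c)}) := by
        refine measureReal_mono fun ω hω => ?_
        simp only [Set.mem_union, Set.mem_ofPred_eq, lt_abs] at hω ⊢
        refine hω.imp le_of_lt fun hneg => hneg.le.trans_eq ?_
        rw [← Finset.sum_neg_distrib]
        exact Finset.sum_congr rfl fun l _ => by ring
    _ ≤ κ / 2 + κ / 2 := (measureReal_union_le _ _).trans (add_le_add hupper hlower)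
    _ = κ := add_halves κ

theorem measure_le_of_section_le {α β : Type*} {mα : MeasurableSpace α} {mβ : MeasurableSpace β}
    (hm : m ≤ mΩ) {U : Ω → α} {Z : Ω → β} (hU : Measurable[m] U)
    (hZ : Measurable Z) (hind : Indep (MeasurableSpace.comap Z mβ) m P) {A : Set (α × β)}
    (hA : MeasurableSet A) {κ : ℝ≥0∞} (h : ∀ᵐ ω ∂P, P {ω' | (U ω, Z ω') ∈ A} ≤ κ) :
    P {ω | (U ω, Z ω) ∈ A} ≤ κ := by
  have hU' : Measurable U := hU.mono hm le_rfl
  have hUZ : IndepFun U Z P :=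
    (IndepFun_iff_Indep U Z P).2 (indep_of_indep_of_le_left hind.symm hU.comap_le)
  have hmap := (indepFun_iff_map_prod_eq_prod_map_map hU'.aemeasurable hZ.aemeasurable).1 hUZ
  have := Measure.isProbabilityMeasure_map (μ := P) hU'.aemeasurable
  have := Measure.isProbabilityMeasure_map (μ := P) hZ.aemeasurable
  calc P {ω | (U ω, Z ω) ∈ A} = (P.map fun ω => (U ω, Z ω)) A :=
        (Measure.map_apply (hU'.prodMk hZ) hA).symm
    _ = ∫⁻ u, (P.map Z) (Prod.mk u ⁻¹' A) ∂(P.map U) := by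
        rw [hmap, Measure.prod_apply hA]
    _ = ∫⁻ ω, (P.map Z) (Prod.mk (U ω) ⁻¹' A) ∂P :=
        lintegral_map (measurable_measure_prodMk_left hA) hU'
    _ ≤ ∫⁻ _, κ ∂P := by
        refine lintegral_mono_ae ?_
        filter_upwards [h] with ω hω
        rwa [Measure.map_apply hZ (measurable_prodMk_left hA)]
    _ = κ := by simp

theorem exists_measure_norm_gt_le {E : Type*} [NormedAddCommGroup E] [MeasurableSpace E]
    [BorelSpace E] [CompleteSpace E] [SecondCountableTopology E] {X : Ω → E} (hX : Measurable X)
    {κ : ℝ≥0∞} (hκ : 0 < κ) : ∃ C : ℝ, P {ω | C < ‖X ω‖} ≤ κ := by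
  have htight := tendsto_measure_norm_gt_of_isTightMeasureSet
    (isTightMeasureSet_singleton (μ := P.map X))
  obtain ⟨C, hC⟩ := (htight.eventually (ge_mem_nhds hκ)).exists
  refine ⟨C, ?_⟩
  rwa [iSup_singleton, Measure.map_apply hX (measurableSet_lt measurable_const measurable_norm)]
    at hC

theorem exists_measurableSet_forall_of_measure_le {q : ℕ → Ω → Prop} {δs : ℕ → ℝ} {δ : ℝ}
    (hδs : ∀ t, 0 ≤ δs t) (hδ : HasSum δs δ) (h : ∀ t, P {ω | ¬ q t ω} ≤ ENNReal.ofReal (δs t)) :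
    ∃ G, MeasurableSet G ∧ 1 - δ ≤ P.real G ∧ ∀ ω ∈ G, ∀ t, q t ω := by
  set bad : Set Ω := ⋃ t, {ω | ¬ q t ω}
  have hbad : P bad ≤ ENNReal.ofReal δ :=
    calc P bad ≤ ∑' t, ENNReal.ofReal (δs t) :=
          (measure_iUnion_le _).trans (ENNReal.tsum_le_tsum h)
      _ = ENNReal.ofReal δ := by
          rw [← ENNReal.ofReal_tsum_of_nonneg hδs hδ.summable, hδ.tsum_eq]
  refine ⟨(toMeasurable P bad)ᶜ, (measurableSet_toMeasurable P bad).compl, ?_, fun ω hω t => ?_⟩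
  · rw [probReal_compl_eq_one_sub (measurableSet_toMeasurable P bad), measureReal_def,
      measure_toMeasurable]
    exact sub_le_sub_left (ENNReal.toReal_le_of_le_ofReal (hδ.nonneg hδs) hbad) 1
  · by_contra hq
    exact hω (subset_toMeasurable P bad (Set.mem_iUnion.2 ⟨t, hq⟩))

end Concentration

section MonteCarlo

/-- The sum of the values of `ψ` at `√v ε_l + μ` for the first `N` samples, whose expectation
under standard normal samples is `N * smooth ψ μ v`. -/
def sampleSum (ψ : ℝ → ℝ) (μ v : ℝ) (N : ℕ) (ε : ℕ → ℝ) : ℝ :=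
  ∑ l ∈ Finset.range N, ψ (√v * ε l + μ)

/-- The Monte Carlo estimate of `smooth ψ μ v` from `N` samples has relative error at most `γ`, or
absolute error at most `γ` where `smooth ψ μ v` vanishes. Both sides are multiplied by `N`. -/
def IsAccurate (γ : ℝ) (ψ : ℝ → ℝ) (μ v : ℝ) (N : ℕ) (ε : ℕ → ℝ) : Prop :=
  |sampleSum ψ μ v N ε - N * smooth ψ μ v| ≤ N * (γ * Model.absOrOne (smooth ψ μ v))

theorem absOrOne_pos (x : ℝ) : 0 < Model.absOrOne x := by
  unfold Model.absOrOne
  split_ifs with h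
  · exact abs_pos.2 h
  · exact one_pos

theorem absOrOne_le_abs_add_one (x : ℝ) : Model.absOrOne x ≤ |x| + 1 := by
  unfold Model.absOrOne
  split_ifs
  · exact le_add_of_nonneg_right zero_le_one
  · exact le_add_of_nonneg_left (abs_nonneg x)

theorem absOrOne_of_pos {x : ℝ} (hx : 0 < x) : Model.absOrOne x = x := by
  rw [Model.absOrOne, if_pos hx.ne', abs_of_pos hx]

theorem measurable_absOrOne : Measurable Model.absOrOne :=
  Measurable.ite (measurableSet_singleton (0 : ℝ)).compl continuous_abs.measurable
    measurable_const

theorem measurable_smooth {ψ : ℝ → ℝ} (hψ : Measurable ψ) :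
    Measurable fun u : ℝ × ℝ => smooth ψ u.1 u.2 := by
  have hjoint : StronglyMeasurable fun x : (ℝ × ℝ) × ℝ => ψ (√x.1.2 * x.2 + x.1.1) :=
    (hψ.comp (by fun_prop)).stronglyMeasurable
  exact hjoint.integral_prod_right.measurable

theorem measurable_sampleSum {ψ : ℝ → ℝ} (hψ : Measurable ψ) :
    Measurable fun x : ((ℝ × ℝ) × ℕ) × (ℕ → ℝ) => sampleSum ψ x.1.1.1 x.1.1.2 x.1.2 x.2 := by
  have hsum : Measurable fun y : ((ℝ × ℝ) × (ℕ → ℝ)) × ℕ =>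
      sampleSum ψ y.1.1.1 y.1.1.2 y.2 y.1.2 :=
    measurable_from_prod_countable_left fun N =>
      Finset.measurable_sum (Finset.range N) fun l _ => hψ.comp
        (by fun_prop : Measurable fun y : (ℝ × ℝ) × (ℕ → ℝ) => √y.1.2 * y.2 l + y.1.1)
  exact hsum.comp (by fun_prop : Measurable fun x : ((ℝ × ℝ) × ℕ) × (ℕ → ℝ) =>
    ((x.1.1, x.2), x.1.2))

theorem measurableSet_not_isAccurate (γ : ℝ) {ψ : ℝ → ℝ} (hψ : Measurable ψ) :
    MeasurableSet {x : ((ℝ × ℝ) × ℕ) × (ℕ → ℝ) |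
      ¬ IsAccurate γ ψ x.1.1.1 x.1.1.2 x.1.2 x.2} := by
  have hsmooth : Measurable fun x : ((ℝ × ℝ) × ℕ) × (ℕ → ℝ) => smooth ψ x.1.1.1 x.1.1.2 :=
    (measurable_smooth hψ).comp (measurable_fst.comp measurable_fst)
  have hN : Measurable fun x : ((ℝ × ℝ) × ℕ) × (ℕ → ℝ) => (x.1.2 : ℝ) := by fun_prop
  exact (measurableSet_le ((measurable_sampleSum hψ).sub (hN.mul hsmooth)).abs
    (hN.mul ((measurable_absOrOne.comp hsmooth).const_mul γ))).compl

variable {Ω : Type*} {m mΩ : MeasurableSpace Ω} {P : Measure Ω} [IsProbabilityMeasure P]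
  {ε : ℕ → Ω → ℝ} {ψ : ℝ → ℝ} {a b γ κ : ℝ}

theorem measure_not_isAccurate_le_of_const (hε : ∀ l, Measurable (ε l))
    (hlaw : ∀ l, HasLaw (ε l) (gaussianReal 0 1) P) (hiid : iIndepFun ε P) (hψ : Measurable ψ)
    (hab : ∀ x, ψ x ∈ Set.Icc a b) (hγ : 0 ≤ γ) (hκ : 0 < κ) {μ v : ℝ} {N : ℕ}
    (h : Real.log (2 / κ) * (b - a) ^ 2 ≤
      2 * N * (γ * Model.absOrOne (smooth ψ μ v)) ^ 2) :
    P {ω | ¬ IsAccurate γ ψ μ v N fun l => ε l ω} ≤ ENNReal.ofReal κ := by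
  have hf : Measurable fun x => ψ (√v * x + μ) := hψ.comp (by fun_prop)
  have hmean : ∀ l, ∫ ω, ψ (√v * ε l ω + μ) ∂P = smooth ψ μ v := fun l => by
    rw [smooth, ← (hlaw l).map_eq, integral_map (hε l).aemeasurable hf.aestronglyMeasurable]
  have hdeviation := measureReal_abs_sum_sub_gt_le (fun l => hf.comp (hε l))
    (hiid.comp (fun _ x => ψ (√v * x + μ)) fun _ => hf) (fun l ω => hab _) hmean
    (mul_nonneg hγ (absOrOne_pos _).le) hκ h
  rw [← ofReal_measureReal]
  refine ENNReal.ofReal_le_ofReal (le_trans (measureReal_mono fun ω hω => ?_) hdeviation)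
  simpa [IsAccurate, sampleSum] using hω

theorem measure_not_isAccurate_le (hm : m ≤ mΩ) {U : Ω → ℝ × ℝ} {N : Ω → ℕ}
    (hU : Measurable[m] U) (hN : Measurable[m] N) (hε : ∀ l, Measurable (ε l))
    (hlaw : ∀ l, HasLaw (ε l) (gaussianReal 0 1) P) (hiid : iIndepFun ε P)
    (hind : Indep (MeasurableSpace.comap (fun ω l => ε l ω) MeasurableSpace.pi) m P)
    (hψ : Measurable ψ) (hab : ∀ x, ψ x ∈ Set.Icc a b) (hγ : 0 ≤ γ) (hκ : 0 < κ)
    (h : ∀ᵐ ω ∂P, Real.log (2 / κ) * (b - a) ^ 2 ≤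
      2 * N ω * (γ * Model.absOrOne (smooth ψ (U ω).1 (U ω).2)) ^ 2) :
    P {ω | ¬ IsAccurate γ ψ (U ω).1 (U ω).2 (N ω) fun l => ε l ω} ≤ ENNReal.ofReal κ := by
  refine measure_le_of_section_le hm (U := fun ω => (U ω, N ω)) (Z := fun ω l => ε l ω)
    (hU.prodMk hN) (measurable_pi_lambda _ hε) hind (measurableSet_not_isAccurate γ hψ) ?_
  filter_upwards [h] with ω hω
  exact measure_not_isAccurate_le_of_const hε hlaw hiid hψ hab hγ hκ hω

theorem abs_div_sub_div_le {s₀ s₁ e₀ e₁ N γ η ζ M : ℝ} (hN : 0 < N) (hγ : 0 ≤ γ)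
    (hγ' : γ ≤ 1 / 2) (hζ : 0 < ζ) (he₀ : ζ ≤ e₀) (he₁ : |e₁| ≤ M) (hη : η ≤ M + 1)
    (h₀ : |s₀ - N * e₀| ≤ N * (γ * e₀)) (h₁ : |s₁ - N * e₁| ≤ N * (γ * η)) :
    |s₁ / s₀ - e₀⁻¹ * e₁| ≤ γ * (4 * (M + 1) / ζ) := by
  have he : 0 < e₀ := hζ.trans_le he₀
  have hM : 0 ≤ M := (abs_nonneg _).trans he₁
  have hs : N * e₀ / 2 ≤ s₀ := by
    have hhalf : γ * (N * e₀) ≤ 1 / 2 * (N * e₀) := by gcongr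
    linarith [(abs_le.1 h₀).1]
  have hs₀ : 0 < s₀ := lt_of_lt_of_le (by positivity) hs
  have hquotient : s₁ / s₀ - e₀⁻¹ * e₁ =
      ((s₁ - N * e₁) * e₀ - e₁ * (s₀ - N * e₀)) / (s₀ * e₀) := by
    field_simp
    ring
  have hnumerator : |(s₁ - N * e₁) * e₀ - e₁ * (s₀ - N * e₀)| ≤ 2 * (N * γ * e₀ * (M + 1)) :=
    calc _ ≤ |s₁ - N * e₁| * e₀ + |e₁| * |s₀ - N * e₀| := by
          refine (abs_sub _ _).trans_eq ?_
          rw [abs_mul, abs_mul, abs_of_pos he]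
      _ ≤ N * (γ * (M + 1)) * e₀ + (M + 1) * (N * (γ * e₀)) := by
          gcongr
          · exact h₁.trans (by gcongr)
          · linarith
      _ = _ := by ring
  rw [hquotient, abs_div, abs_of_pos (by positivity : 0 < s₀ * e₀)]
  calc _ ≤ 2 * (N * γ * e₀ * (M + 1)) / (N * e₀ / 2 * ζ) := by gcongr
    _ = γ * (4 * (M + 1) / ζ) := by
        field_simp
        ring

theorem IsAccurate.abs_div_sub_le {ψ₀ ψ₁ : ℝ → ℝ} {M : ℝ≥0} {ζ μ v : ℝ} {N : ℕ} {ε : ℕ → ℝ}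
    (h₀ : IsAccurate γ ψ₀ μ v N ε) (h₁ : IsAccurate γ ψ₁ μ v N ε) (hN : 0 < N) (hγ : 0 ≤ γ)
    (hγ' : γ ≤ 1 / 2) (hζ : 0 < ζ) (hψ₀ : ζ ≤ smooth ψ₀ μ v) (hψ₁ : ∀ x, |ψ₁ x| ≤ M) :
    |sampleSum ψ₁ μ v N ε / sampleSum ψ₀ μ v N ε - (smooth ψ₀ μ v)⁻¹ * smooth ψ₁ μ v| ≤
      γ * (4 * (M + 1) / ζ) := by
  rw [IsAccurate, absOrOne_of_pos (hζ.trans_le hψ₀)] at h₀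
  have hM := abs_smooth_le hψ₁ μ v
  exact abs_div_sub_div_le (Nat.cast_pos.2 hN) hγ hγ' hζ hψ₀ hM
    ((absOrOne_le_abs_add_one _).trans (by linarith)) h₀ h₁

end MonteCarlo

section DirectionError

namespace Model

variable {Y : Type*} {n k : ℕ} {D : Model Y n k} {M ζ lam : ℝ≥0} {r : Param k}

theorem exampleDirection_eq (i : Fin n) (L : ℕ) (ε : ℕ → ℝ) (r : Param k) :
    D.exampleDirection i L ε r = D.direction i
      (sampleSum (deriv (D.p (D.y i))) (D.mean i r) (D.var i r) L ε /
        sampleSum (D.p (D.y i)) (D.mean i r) (D.var i r) L ε)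
      (sampleSum (deriv (deriv (D.p (D.y i)))) (D.mean i r) (D.var i r) L ε /
        sampleSum (D.p (D.y i)) (D.mean i r) (D.var i r) L ε) := by
  refine congrArg (WithLp.toLp 2) (Prod.ext ?_ ?_)
  · simp [meanGradient, varGradient, sampleSum, φ, φ', g]
  · simp [meanGradient, varGradient, sampleSum, φ, φ'', g]

theorem norm_exampleDirection_sub_le {i : Fin n} (hD : BoundedDerivs M (D.p (D.y i))) (hζ : 0 < ζ)
    (hr : r ∈ D.domain ζ lam) {γ : ℝ} (hγ : 0 ≤ γ) (hγ' : γ ≤ 1 / 2) {L : ℕ} (hL : 0 < L)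
    {ε : ℕ → ℝ} (hε : ∀ j : Fin 3, IsAccurate γ (deriv^[j] (D.p (D.y i))) (D.mean i r)
      (D.var i r) L ε) :
    ‖D.exampleDirection i L ε r - (D.predictive i r)⁻¹ • D.predictiveGradient i r‖ ≤
      γ * (4 * (M + 1) / ζ * (‖D.meanGradient i‖ + ‖D.varGradient i‖)) := by
  have hsmooth := eqOn_predictive_smooth hD (hr.2.1 i)
  have hζ_le := (hr.1 i).trans_eq hsmooth
  rw [exampleDirection_eq, hsmooth, predictiveGradient, smul_direction, direction_sub]
  calc _ ≤ γ * (4 * (M + 1) / ζ) * ‖D.meanGradient i‖ +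
        γ * (4 * (M + 1) / ζ) * ‖D.varGradient i‖ := by
        refine (D.norm_direction_le i _ _).trans ?_
        gcongr
        · exact (hε 0).abs_div_sub_le (hε 1) hL hγ hγ' hζ hζ_le hD.abs_deriv_le
        · exact (hε 0).abs_div_sub_le (hε 2) hL hγ hγ' hζ hζ_le hD.abs_deriv_deriv_le
    _ = _ := by ring

theorem exists_norm_bmcDirection_add_objectiveGradient_le
    (hD : ∀ i, BoundedDerivs M (D.p (D.y i))) (hβ : 0 ≤ D.β) (hK : D.K₀.PosDef) (hζ : 0 < ζ)
    (hlam : 0 < lam) :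
    ∃ C : ℝ, ∀ r ∈ D.domain ζ lam, ∀ γ, 0 ≤ γ → γ ≤ 1 / 2 → ∀ L, 0 < L → ∀ ε : Fin n → ℕ → ℝ,
      (∀ x : Fin n × Fin 3, IsAccurate γ (deriv^[x.2] (D.p (D.y x.1))) (D.mean x.1 r)
        (D.var x.1 r) L (ε x.1)) →
      ‖D.bmcDirection L ε r + D.objectiveGradient r‖ ≤ γ * C := by
  refine ⟨1 / n * ∑ i, 4 * (M + 1) / ζ * (‖D.meanGradient i‖ + ‖D.varGradient i‖),
    fun r hr γ hγ hγ' L hL ε hε => ?_⟩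
  rw [bmcDirection_add_objectiveGradient hβ hK hlam hr, norm_smul,
    Real.norm_of_nonneg (by positivity), mul_left_comm, Finset.mul_sum]
  gcongr
  exact norm_sum_le_of_le _ fun i _ =>
    norm_exampleDirection_sub_le (hD i) hζ hr hγ hγ' hL fun j => hε (i, j)

theorem DerivativeBounds.exists_range_subset_Icc {B b' B' b'' B'' : ℝ}
    (hB : D.DerivativeBounds B b' B' b'' B'') (i : Fin n) (j : Fin 3) :
    ∃ a b, (∀ x, deriv^[j] (D.p (D.y i)) x ∈ Set.Icc a b) ∧
      ∀ r, smooth (D.p (D.y i)) (D.mean i r) (D.var i r) ≠ 0 →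
        (b - a) ^ 2 / absOrOne (smooth (deriv^[j] (D.p (D.y i))) (D.mean i r) (D.var i r)) ^ 2 ≤
          D.sampleFactor B b' B' b'' B'' i r := by
  fin_cases j
  · refine ⟨0, B, hB.bound i, fun r hr => le_max_of_le_left ?_⟩
    rw [sub_zero]
    exact (congrArg (B ^ 2 / · ^ 2) (if_pos hr)).le
  · exact ⟨b', B', hB.bound' i, fun r _ => (le_max_left _ _).trans (le_max_right _ _)⟩
  · exact ⟨b'', B'', hB.bound'' i, fun r _ => (le_max_right _ _).trans (le_max_right _ _)⟩

theorem sampleFactor_nonneg (B b' B' b'' B'' : ℝ) (i : Fin n) (r : Param k) :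
    0 ≤ D.sampleFactor B b' B' b'' B'' i r :=
  le_max_of_le_left (by positivity)

end Model

theorem BoundedDerivs.measurable_iterate_deriv {M : ℝ≥0} {ψ : ℝ → ℝ} (h : BoundedDerivs M ψ) :
    ∀ j : ℕ, Measurable (deriv^[j] ψ)
  | 0 => h.differentiable.continuous.measurable
  | j + 1 => by
      rw [Function.iterate_succ_apply']
      exact measurable_deriv _

end DirectionError

section Run

theorem log_mul_sq_le_of_lt {x w η γ F N : ℝ} (hx : 0 ≤ x) (hγ : 0 < γ) (hη : 0 < η)
    (hF : w ^ 2 / η ^ 2 ≤ F) (hN : x / (2 * γ ^ 2) * F < N) :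
    x * w ^ 2 ≤ 2 * N * (γ * η) ^ 2 :=
  calc x * w ^ 2 = 2 * (x / (2 * γ ^ 2) * (w ^ 2 / η ^ 2)) * (γ * η) ^ 2 := by field_simp
    _ ≤ 2 * (x / (2 * γ ^ 2) * F) * (γ * η) ^ 2 := by gcongr
    _ ≤ 2 * N * (γ * η) ^ 2 := by gcongr

theorem measure_not_forall_le {Ω ι : Type*} {mΩ : MeasurableSpace Ω} {P : Measure Ω} [Fintype ι]
    {q : ι → Ω → Prop} {κ : ℝ} (h : ∀ i, P {ω | ¬ q i ω} ≤ ENNReal.ofReal κ) :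
    P {ω | ¬ ∀ i, q i ω} ≤ ENNReal.ofReal (Fintype.card ι * κ) :=
  calc P {ω | ¬ ∀ i, q i ω} = P (⋃ i, {ω | ¬ q i ω}) := by
        congr 1
        ext ω
        simp
    _ ≤ ∑ i, P {ω | ¬ q i ω} := measure_iUnion_fintype_le _ _
    _ ≤ ∑ _i : ι, ENNReal.ofReal κ := Finset.sum_le_sum fun i _ => h i
    _ = ENNReal.ofReal (Fintype.card ι * κ) := by
        rw [Finset.sum_const, Finset.card_univ, nsmul_eq_mul,
          ENNReal.ofReal_mul (Nat.cast_nonneg _), ENNReal.ofReal_natCast]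

/-- The direction of step `t` of a bMC run. -/
def runDirection {Y Ω : Type*} {n k : ℕ} (D : Model Y n k) (L : ℕ → Ω → ℕ)
    (ε : ℕ → Fin n → ℕ → Ω → ℝ) (r : ℕ → Ω → Param k) (t : ℕ) (ω : Ω) : Param k :=
  D.bmcDirection (L t ω) (fun i l => ε t i l ω) (r t ω)

namespace IsBMCRun

variable {Y : Type*} {n k : ℕ} {D : Model Y n k} {M ζ lam : ℝ≥0} {Ω : Type*}
  {mΩ : MeasurableSpace Ω} {P : Measure Ω} [IsProbabilityMeasure P] {ℱ : Filtration ℕ mΩ}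
  {γ : ℕ → ℝ} {L : ℕ → Ω → ℕ} {ε : ℕ → Fin n → ℕ → Ω → ℝ} {r : ℕ → Ω → Param k}
  (hrun : IsBMCRun D P ℱ γ L ε r)

include hrun

theorem measure_not_isAccurate_le {ψ : ℝ → ℝ} (hψ : Measurable ψ) {a b : ℝ}
    (hab : ∀ x, ψ x ∈ Set.Icc a b) {t : ℕ} (hγ : 0 ≤ γ t) {κ : ℝ} (hκ : 0 < κ) {i : Fin n}
    (h : ∀ᵐ ω ∂P, Real.log (2 / κ) * (b - a) ^ 2 ≤ 2 * L t ω *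
      (γ t * Model.absOrOne (smooth ψ (D.mean i (r t ω)) (D.var i (r t ω)))) ^ 2) :
    P {ω | ¬ IsAccurate (γ t) ψ (D.mean i (r t ω)) (D.var i (r t ω)) (L t ω)
      fun l => ε t i l ω} ≤ ENNReal.ofReal κ := by
  have hmean := (lipschitzWith_of_sub_eq_inner (D.mean_sub i)).continuous
  have hU : Measurable[ℱ t] fun ω => (D.mean i (r t ω), D.var i (r t ω)) :=
    (hmean.comp_stronglyMeasurable (hrun.adapted t)).measurable.prodMk
      ((D.continuous_var i).comp_stronglyMeasurable (hrun.adapted t)).measurable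
  exact DLM.measure_not_isAccurate_le (ℱ.le t)
    (U := fun ω => (D.mean i (r t ω), D.var i (r t ω))) (N := L t) (ε := ε t i) hU
    (hrun.adapted_size t) (hrun.measurable_sample t i) (hrun.law t i) (hrun.iIndep t i)
    (hrun.indep_past t i) hψ hab hγ hκ h

section Step

variable {B b' B' b'' B'' : ℝ} (hB : D.DerivativeBounds B b' B' b'' B'')
  (hD : ∀ i, BoundedDerivs M (D.p (D.y i))) (hn : 0 < n) (hζ : 0 < ζ) {t : ℕ} (hγ : 0 < γ t)
  {δ : ℝ} (hδ : 0 < δ) (hdom : ∀ᵐ ω ∂P, r t ω ∈ D.domain ζ lam)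
  (hL : ∀ᵐ ω ∂P, ∀ i, Real.log (6 * n / δ) / (2 * γ t ^ 2) *
    D.sampleFactor B b' B' b'' B'' i (r t ω) < L t ω)

include hB hD hn hζ hγ hδ hdom hL

theorem measure_not_forall_isAccurate_le (hlog : 0 ≤ Real.log (6 * n / δ)) :
    P {ω | ¬ ∀ x : Fin n × Fin 3, IsAccurate (γ t) (deriv^[x.2] (D.p (D.y x.1)))
      (D.mean x.1 (r t ω)) (D.var x.1 (r t ω)) (L t ω) fun l => ε t x.1 l ω} ≤
        ENNReal.ofReal δ := by
  have : (0 : ℝ) < n := Nat.cast_pos.2 hn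
  have hκ : 2 / (δ / (3 * n)) = 6 * n / δ := by
    field_simp
    norm_num
  have hcard : Fintype.card (Fin n × Fin 3) * (δ / (3 * n)) = δ := by
    simp only [Fintype.card_prod, Fintype.card_fin, Nat.cast_mul, Nat.cast_ofNat]
    field_simp
  refine (measure_not_forall_le fun x => ?_).trans_eq (congrArg ENNReal.ofReal hcard)
  obtain ⟨a, b, hab, hfactor⟩ := hB.exists_range_subset_Icc x.1 x.2
  refine hrun.measure_not_isAccurate_le ((hD x.1).measurable_iterate_deriv x.2) hab hγ.le
    (by positivity) ?_
  filter_upwards [hdom, hL] with ω hω hLω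
  have hpos : 0 < smooth (D.p (D.y x.1)) (D.mean x.1 (r t ω)) (D.var x.1 (r t ω)) :=
    (NNReal.coe_pos.2 hζ).trans_le
      ((hω.1 x.1).trans_eq (Model.eqOn_predictive_smooth (hD x.1) (hω.2.1 x.1)))
  rw [hκ]
  exact log_mul_sq_le_of_lt hlog hγ (absOrOne_pos _) (hfactor _ hpos.ne') (hLω x.1)

theorem measure_norm_add_gradient_gt_le {C : ℝ}
    (hC : ∀ r ∈ D.domain ζ lam, ∀ γ, 0 ≤ γ → γ ≤ 1 / 2 → ∀ L, 0 < L → ∀ ε : Fin n → ℕ → ℝ,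
      (∀ x : Fin n × Fin 3, IsAccurate γ (deriv^[x.2] (D.p (D.y x.1))) (D.mean x.1 r)
        (D.var x.1 r) L (ε x.1)) →
      ‖D.bmcDirection L ε r + D.objectiveGradient r‖ ≤ γ * C) (ht : γ t ≤ 1 / 2) :
    P {ω | γ t * C < ‖runDirection D L ε r t ω + D.objectiveGradient (r t ω)‖} ≤
      ENNReal.ofReal δ := by
  rcases le_total 1 δ with hδ' | hδ'
  · exact prob_le_one.trans (ENNReal.one_le_ofReal.2 hδ')
  have hlog : 0 ≤ Real.log (6 * n / δ) := by
    have hn' : (1 : ℝ) ≤ n := Nat.one_le_cast.2 hn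
    refine Real.log_nonneg ((one_le_div hδ).2 ?_)
    linarith
  refine (measure_mono_ae ?_).trans
    (hrun.measure_not_forall_isAccurate_le hB hD hn hζ hγ hδ hdom hL hlog)
  filter_upwards [hdom, hL] with ω hω hLω herror hε
  have hLpos : (0 : ℝ) < L t ω :=
    (mul_nonneg (by positivity) (Model.sampleFactor_nonneg _ _ _ _ _ ⟨0, hn⟩ _)).trans_lt
      (hLω ⟨0, hn⟩)
  exact not_le.2 (Set.mem_ofPred.1 herror)
    (hC _ hω _ hγ.le ht _ (Nat.cast_pos.1 hLpos) _ hε)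

end Step

theorem exists_measure_norm_runDirection_gt_le {t : ℕ} (hγ : γ t ≠ 0) {κ : ℝ≥0∞} (hκ : 0 < κ) :
    ∃ C : ℝ, P {ω | C < ‖runDirection D L ε r t ω‖} ≤ κ := by
  have hr : ∀ s, Measurable (r s) := fun s => ((hrun.adapted s).mono (ℱ.le s)).measurable
  have hdirection : Measurable (runDirection D L ε r t) := by
    convert ((hr (t + 1)).sub (hr t)).const_smul (γ t)⁻¹ using 1
    ext1 ω
    rw [Pi.smul_apply, Pi.sub_apply, hrun.step, add_sub_cancel_left, inv_smul_smul₀ hγ]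
    rfl
  exact exists_measure_norm_gt_le hdirection hκ

theorem exists_measure_norm_add_gradient_gt_le {t : ℕ} (hγ : 1 / 2 ≤ γ t) {κ : ℝ≥0∞}
    (hκ : 0 < κ) : ∃ C : ℝ, P {ω | γ t * (C + 2 * ‖D.objectiveGradient (r t ω)‖) <
      ‖runDirection D L ε r t ω + D.objectiveGradient (r t ω)‖} ≤ κ := by
  obtain ⟨C, hC⟩ := hrun.exists_measure_norm_runDirection_gt_le (by positivity : γ t ≠ 0) hκ
  refine ⟨2 * max C 0, (measure_mono fun ω hω => ?_).trans hC⟩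
  by_contra hdirection
  refine absurd (Set.mem_ofPred.1 hω) (not_lt.2 ?_)
  calc _ ≤ max C 0 + ‖D.objectiveGradient (r t ω)‖ :=
        norm_add_le_of_le ((not_lt.1 hdirection).trans (le_max_left _ _)) le_rfl
    _ = 1 / 2 * (2 * max C 0 + 2 * ‖D.objectiveGradient (r t ω)‖) := by ring
    _ ≤ γ t * (2 * max C 0 + 2 * ‖D.objectiveGradient (r t ω)‖) := by gcongr

section Error

variable {B b' B' b'' B'' : ℝ} (hB : D.DerivativeBounds B b' B' b'' B'')
  (hD : ∀ i, BoundedDerivs M (D.p (D.y i))) (hβ : 0 ≤ D.β) (hK : D.K₀.PosDef) (hn : 0 < n)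
  (hζ : 0 < ζ) (hlam : 0 < lam) (hγ : ∀ t, 0 < γ t) (hγ₀ : Tendsto γ atTop (𝓝 0))
  {δs : ℕ → ℝ} (hδs : ∀ t, 0 < δs t) (hdom : ∀ᵐ ω ∂P, ∀ t, r t ω ∈ D.domain ζ lam)
  (hL : ∀ᵐ ω ∂P, ∀ t i, Real.log (6 * n / δs t) / (2 * γ t ^ 2) *
    D.sampleFactor B b' B' b'' B'' i (r t ω) < L t ω)

include hB hD hβ hK hn hζ hlam hγ hγ₀ hδs hdom hL

theorem exists_forall_measure_norm_add_gradient_gt_le :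
    ∃ c, 0 < c ∧ ∀ t, P {ω | γ t * (c + 2 * ‖D.objectiveGradient (r t ω)‖) <
      ‖runDirection D L ε r t ω + D.objectiveGradient (r t ω)‖} ≤ ENNReal.ofReal (δs t) := by
  obtain ⟨C₀, hC₀⟩ := Model.exists_norm_bmcDirection_add_objectiveGradient_le hD hβ hK hζ hlam
  have hstep : ∀ t, ∃ C : ℝ, (γ t < 1 / 2 → C = C₀) ∧
      P {ω | γ t * (C + 2 * ‖D.objectiveGradient (r t ω)‖) <
        ‖runDirection D L ε r t ω + D.objectiveGradient (r t ω)‖} ≤ ENNReal.ofReal (δs t) := by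
    intro t
    rcases lt_or_ge (γ t) (1 / 2) with ht | ht
    · refine ⟨C₀, fun _ => rfl, (measure_mono fun ω hω => ?_).trans
        (hrun.measure_norm_add_gradient_gt_le hB hD hn hζ (hγ t) (hδs t)
          (hdom.mono fun ω h => h t) (hL.mono fun ω h => h t) hC₀ ht.le)⟩
      refine lt_of_le_of_lt ?_ (Set.mem_ofPred.1 hω)
      exact mul_le_mul_of_nonneg_left (le_add_of_nonneg_right (by positivity)) (hγ t).le
    · obtain ⟨C, hC⟩ := hrun.exists_measure_norm_add_gradient_gt_le ht
        (ENNReal.ofReal_pos.2 (hδs t))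
      exact ⟨C, fun hlt => absurd ht hlt.not_ge, hC⟩
  choose C hC hP using hstep
  obtain ⟨c, hc⟩ : BddAbove (Set.range C) := by
    refine Tendsto.bddAbove_range (a := C₀) (tendsto_const_nhds.congr' ?_)
    filter_upwards [hγ₀.eventually_lt_const one_half_pos] with t ht using (hC t ht).symm
  refine ⟨max c 1, lt_max_of_lt_right one_pos, fun t => (measure_mono fun ω hω => ?_).trans (hP t)⟩
  refine lt_of_le_of_lt ?_ (Set.mem_ofPred.1 hω)
  exact mul_le_mul_of_nonneg_left
    (add_le_add_left (le_max_of_le_left (hc (Set.mem_range_self t))) _) (hγ t).le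

theorem exists_forall_measure_not_error_le :
    ∃ c, 0 < c ∧ ∀ t, P {ω | ¬ (r t ω ∈ D.domain ζ lam ∧
      ‖runDirection D L ε r t ω + ∇ D.objective (r t ω)‖ ≤
        γ t * (c + 2 * ‖∇ D.objective (r t ω)‖))} ≤ ENNReal.ofReal (δs t) := by
  obtain ⟨c, hc, hP⟩ := hrun.exists_forall_measure_norm_add_gradient_gt_le hB hD hβ hK hn hζ hlam
    hγ hγ₀ hδs hdom hL
  refine ⟨c, hc, fun t => (measure_mono_ae ?_).trans (hP t)⟩
  filter_upwards [hdom] with ω hω herror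
  refine Set.mem_ofPred.2 ?_
  rw [← (Model.hasGradientAt_objective hD hβ hK hζ hlam (hω t)).gradient]
  exact not_le.1 fun hle => absurd (And.intro (hω t) hle) (Set.mem_ofPred.1 herror)

end Error

end IsBMCRun

theorem GradientMethodWithErrors.of_norm_add_gradient_le {E : Type*} [NormedAddCommGroup E]
    [InnerProductSpace ℝ E] [CompleteSpace E] {h : E → ℝ} {S : Set E} {γ : ℕ → ℝ} {r d : ℕ → E}
    {c₃ c₄ : ℝ} {Λ : ℝ≥0} (hmem : ∀ t, r t ∈ S) (hstep : ∀ t, r (t + 1) = r t + γ t • d t)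
    (herror : ∀ t, ‖d t + ∇ h (r t)‖ ≤ γ t * (c₃ + c₄ * ‖∇ h (r t)‖))
    (hdiff : ∀ x ∈ S, DifferentiableAt ℝ h x) (hlip : LipschitzOnWith Λ (∇ h) S)
    (hγ_sq : Summable fun t => γ t ^ 2)
    (hγ_sum : Tendsto (fun T => ∑ t ∈ Finset.range T, γ t) atTop atTop) :
    GradientMethodWithErrors h S γ r d 1 1 c₃ c₄ Λ where
  mem := hmem
  step := hstep
  decomposition := by
    refine ⟨fun t => -∇ h (r t), fun t => d t + ∇ h (r t), fun t =>
      ⟨(neg_add_cancel_comm_assoc _ _).symm, ?_, ?_, herror t⟩⟩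
    · rw [inner_neg_right, neg_neg, real_inner_self_eq_norm_sq, one_mul]
    · rw [norm_neg, one_mul]
  differentiable := hdiff
  lipschitz := hlip
  summable_sq := hγ_sq
  sum_tendsto := hγ_sum

end Run

end DLM

end

theorem mainTheorem1 {Y : Type*} {n k : ℕ} (hn : 0 < n) (D : DLM.Model Y n k)
    (hβ : 0 ≤ D.β) (hK₀ : D.K₀.PosDef)
    (B b' B' b'' B'' : ℝ) (hB : D.DerivativeBounds B b' B' b'' B'')
    (ζ : ℝ) (hζ : 0 < ζ) (lam : ℝ) (hlam : 0 < lam)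
    (γ : ℕ → ℝ) (hγ : ∀ t, 0 < γ t)
    (hγ_sum : Tendsto (fun T => ∑ t ∈ Finset.range T, γ t) atTop atTop)
    (hγ_sq : Summable fun t => γ t ^ 2)
    (δ : ℝ) (δs : ℕ → ℝ) (hδs : ∀ t, 0 < δs t) (hδ : HasSum δs δ)
    {Ω : Type*} {mΩ : MeasurableSpace Ω} (P : Measure Ω) [IsProbabilityMeasure P]
    (ℱ : Filtration ℕ mΩ) (L : ℕ → Ω → ℕ) (ε : ℕ → Fin n → ℕ → Ω → ℝ)
    (r : ℕ → Ω → DLM.Param k) (hrun : DLM.IsBMCRun D P ℱ γ L ε r)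
    (hdom : ∀ᵐ ω ∂P, ∀ t, r t ω ∈ D.domain ζ lam)
    (hL : ∀ᵐ ω ∂P, ∀ t i, Real.log (6 * n / δs t) / (2 * γ t ^ 2) *
      D.sampleFactor B b' B' b'' B'' i (r t ω) < L t ω) :
    ∃ c₁ c₂ c₃ c₄ : ℝ, 0 < c₁ ∧ 0 < c₂ ∧ 0 < c₃ ∧ 0 < c₄ ∧ ∃ Λ : ℝ≥0,
      ∃ G : Set Ω, MeasurableSet G ∧ 1 - δ ≤ P.real G ∧ ∀ ω ∈ G,
        DLM.GradientMethodWithErrors D.objective (D.domain ζ lam) γ (fun t => r t ω)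
          (fun t => D.bmcDirection (L t ω) (fun i l => ε t i l ω) (r t ω)) c₁ c₂ c₃ c₄ Λ ∧
        (∃ l : ℝ, Tendsto (fun t => D.objective (r t ω)) atTop (𝓝 l)) ∧
        Tendsto (fun t => ∇ D.objective (r t ω)) atTop (𝓝 0) := by
  lift ζ to ℝ≥0 using hζ.le
  lift lam to ℝ≥0 using hlam.le
  obtain ⟨M, hD⟩ := hB.exists_boundedDerivs
  have hgradient := fun x (hx : x ∈ D.domain ζ lam) =>
    DLM.Model.hasGradientAt_objective hD hβ hK₀ hζ hlam hx
  obtain ⟨Λ, hΛ⟩ := DLM.Model.exists_hasLipschitzGradientOn_objective hD hβ hK₀ hζ hlam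
  have hsmooth := hΛ.gradient hgradient
  obtain ⟨c₃, hc₃, herror⟩ := hrun.exists_forall_measure_not_error_le hB hD hβ hK₀ hn hζ hlam hγ
    (DLM.tendsto_zero_of_summable_sq hγ_sq) hδs hdom hL
  obtain ⟨G, hG, hPG, hgood⟩ :=
    DLM.exists_measurableSet_forall_of_measure_le (fun t => (hδs t).le) hδ herror
  refine ⟨1, 1, c₃, 2, one_pos, one_pos, hc₃, two_pos, Λ, G, hG, hPG, fun ω hω => ?_⟩
  have hmem := fun t => (hgood ω hω t).1
  have hmethod := DLM.GradientMethodWithErrors.of_norm_add_gradient_le hmem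
    (fun t => hrun.step t ω) (fun t => (hgood ω hω t).2)
    (fun x hx => (hgradient x hx).differentiableAt) hsmooth.lipschitz hγ_sq hγ_sum
  exact ⟨hmethod, hmethod.tendsto one_pos (fun t => (hγ t).le)
    (fun t => hsmooth.le_add_inner_add (hmem t) (hmem (t + 1)))
    fun t => DLM.Model.neg_log_le_objective hD hβ hζ (hmem t)⟩
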